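/- Let $m,n\ge 1$ be integers. Call a function in $C^\infty((-\infty,0)^n)$ absolutely monotone on $(-\infty,0)^n$ if it is nonnegative together with all its partial derivatives of all orders. Let $\mathcal T_n$ be the class of all nonpositive functions in $C^\infty((-\infty,0)^n)$ all of whose first-order partial derivatives are absolutely monotone. Inequalities between vectors are coordinatewise, $a\cdot b=\sum_i a_ib_i$, $\mathbb R_+=[0,\infty)$, and $s\to-0$ (respectively $s\to-\infty$) means that $s_1\to-0,\dots,s_n\to-0$ (respectively $s_1\to-\infty,\dots,s_n\to-\infty$). Theorem. For a function $\psi:(-\infty,0)^n\to(-\infty,0]$ the following three conditions are equivalent. (1) $\psi\in\mathcal T_n$. (2) The limit $c_0=\psi(-0):=\lim_{s\to-0}\psi(s)$ exists and is finite, $\psi$ is differentiable, the limit $c_1=\nabla\psi(-\infty):=\lim_{s\to-\infty}\nabla\psi(s)$ exists and lies in $\mathbb R_+^n$, and there is a unique positive Radon measure $\mu$ on $\mathbb R_+^n\setminus\{0\}$ such that, for all sufficiently small $\delta>0$, the functions $u\mapsto u_j$ $(j=1,\dots,n)$ are $\mu$-integrable on $[0,\delta)^n\setminus\{0\}$ and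 $\mu(\mathbb R_+^n\setminus[0,\delta)^n)<\infty$, and such that for all $s\in(-\infty,0)^n$ $$\psi(s)=c_0+c_1\cdot s+\int_{\mathbb R_+^n\setminus\{0\}}\left(e^{s\cdot u}-1\right)d\mu(u),$$ where the integral converges absolutely. (3) For every absolutely monotone function $f$ on $(-\infty,0)^m$, the function $(s,r)\mapsto f(\psi(s),r)$, $s\in(-\infty,0)^n$, $r\in(-\infty,0)^{m-1}$, is absolutely monotone on $(-\infty,0)^{m+n-1}$. (If $\psi$ takes the value $0$, this is required only of those $f$ for which the limit $f(0,r):=\lim_{x\to-0}f(x,r)$ is finite for every $r\in(-\infty,0)^{m-1}$, and $f(0,r)$ denotes this limit.) -/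

import Mathlib

open Set Filter Topology MeasureTheory
open scoped ContDiff

noncomputable section

namespace Bernstein

/-- The open negative orthant `(-∞, 0)^n`. -/
def negOrthant (n : ℕ) : Set (Fin n → ℝ) := {s | ∀ i, s i < 0}

/-- The closed positive orthant without the origin, `ℝ_+^n ∖ {0}`. -/
def puncturedOrthant (n : ℕ) : Set (Fin n → ℝ) := {u | (∀ i, 0 ≤ u i) ∧ u ≠ 0}

/-- The half-open cube `[0, δ)^n`. -/
def cube (n : ℕ) (δ : ℝ) : Set (Fin n → ℝ) := {u | ∀ i, 0 ≤ u i ∧ u i < δ}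

/-- The first-order partial derivative `∂f/∂s_i`. -/
def partialDeriv {n : ℕ} (i : Fin n) (f : (Fin n → ℝ) → ℝ) : (Fin n → ℝ) → ℝ :=
  fun s => fderiv ℝ f s (Pi.single i 1)

/-- The iterated partial derivative `∂_{i₁} ⋯ ∂_{i_k} f` for `l = [i₁, …, i_k]`
(and `f` itself for the empty list). -/
def iterPartialDeriv {n : ℕ} (l : List (Fin n)) (f : (Fin n → ℝ) → ℝ) : (Fin n → ℝ) → ℝ :=
  l.foldr partialDeriv f

/-- `f` is absolutely monotone on `(-∞, 0)^n`: it is `C^∞` there, and it is nonnegative there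
together with its partial derivatives of all orders. -/
def AbsolutelyMonotone {n : ℕ} (f : (Fin n → ℝ) → ℝ) : Prop :=
  ContDiffOn ℝ ∞ f (negOrthant n) ∧
    ∀ l : List (Fin n), ∀ s ∈ negOrthant n, 0 ≤ iterPartialDeriv l f s

/-- The class `T_n` of negative Bernstein functions of `n` variables. -/
def ClassT {n : ℕ} (ψ : (Fin n → ℝ) → ℝ) : Prop :=
  ContDiffOn ℝ ∞ ψ (negOrthant n) ∧ (∀ s ∈ negOrthant n, ψ s ≤ 0) ∧
    ∀ i : Fin n, AbsolutelyMonotone (partialDeriv i ψ)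

/-- `μ` is a positive Borel measure on `ℝ_+^n ∖ {0}` (seen as a measure on `ℝ^n` that does not
charge the complement) such that, for all sufficiently small `δ > 0`, the coordinates `u_j` are
`μ`-integrable on `[0, δ)^n ∖ {0}` and `μ (ℝ_+^n ∖ [0, δ)^n) < ∞`. These two properties force
finiteness on compact subsets of `ℝ_+^n ∖ {0}`, so that `μ` is a Radon measure there. -/
def IsLevyMeasure {n : ℕ} (μ : Measure (Fin n → ℝ)) : Prop :=
  μ (puncturedOrthant n)ᶜ = 0 ∧
    ∀ᶠ δ in 𝓝[>] (0 : ℝ),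
      (∀ j, IntegrableOn (fun u : Fin n → ℝ => u j) (cube n δ \ {0}) μ) ∧
        μ ({u | ∀ i, 0 ≤ u i} \ cube n δ) < ⊤

/-- The formula `ψ(s) = c₀ + c₁ · s + ∫_{ℝ_+^n ∖ {0}} (e^{s · u} - 1) dμ(u)` on `(-∞, 0)^n`,
with a convergent integral. -/
def Represents {n : ℕ} (ψ : (Fin n → ℝ) → ℝ) (c₀ : ℝ) (c₁ : Fin n → ℝ)
    (μ : Measure (Fin n → ℝ)) : Prop :=
  ∀ s ∈ negOrthant n,
    IntegrableOn (fun u => Real.exp (s ⬝ᵥ u) - 1) (puncturedOrthant n) μ ∧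
      ψ s = c₀ + c₁ ⬝ᵥ s + ∫ u in puncturedOrthant n, (Real.exp (s ⬝ᵥ u) - 1) ∂μ

/-- `ψ` has the integral representation with `c₀ = ψ(-0)`, `c₁ = ∇ψ(-∞) ≥ 0` and a unique
measure. In `ψ(-0)` all the variables tend to `0` from the left, and in `∇ψ(-∞)` all of them tend
to `-∞`, which is the filter `atBot` of the coordinatewise order. -/
def HasLevyKhintchine {n : ℕ} (ψ : (Fin n → ℝ) → ℝ) : Prop :=
  ∃ (c₀ : ℝ) (c₁ : Fin n → ℝ),
    Tendsto ψ (𝓝[negOrthant n] 0) (𝓝 c₀) ∧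
    DifferentiableOn ℝ ψ (negOrthant n) ∧
    (∀ i, Tendsto (partialDeriv i ψ) atBot (𝓝 (c₁ i))) ∧
    (∀ i, 0 ≤ c₁ i) ∧
    ∃! μ : Measure (Fin n → ℝ), IsLevyMeasure μ ∧ Represents ψ c₀ c₁ μ

/-- The function `(s, r) ↦ f(ψ(s), r)` of `n + k` variables, where `f` has `k + 1` variables. -/
def substFirst {n k : ℕ} (f : (Fin (k + 1) → ℝ) → ℝ) (ψ : (Fin n → ℝ) → ℝ) :
    (Fin (n + k) → ℝ) → ℝ :=
  fun x => f (Fin.cons (ψ fun i => x (Fin.castAdd k i)) fun j => x (Fin.natAdd n j))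

/-- For every absolutely monotone `f` on `(-∞, 0)^{k+1}`, the function `(s, r) ↦ f(ψ(s), r)` is
absolutely monotone on `(-∞, 0)^{n+k}`. If `ψ` takes the value `0`, then `f(ψ(s), r)` involves
values `f(0, r)` outside the domain of `f`; these are the limits of `f(x, r)` as `x → -0`, and only
functions `f` for which all these limits are finite enter. If `ψ < 0`, all `f` enter. -/
def PreservesAbsolutelyMonotone (k : ℕ) {n : ℕ} (ψ : (Fin n → ℝ) → ℝ) : Prop :=
  ∀ f : (Fin (k + 1) → ℝ) → ℝ, AbsolutelyMonotone f →
    ((∃ s ∈ negOrthant n, ψ s = 0) → ∀ r ∈ negOrthant k,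
      Tendsto (fun x : ℝ => f (Fin.cons x r)) (𝓝[<] 0) (𝓝 (f (Fin.cons 0 r)))) →
    AbsolutelyMonotone (substFirst f ψ)

end Bernstein

end

/-! Everything rests on Bernstein's theorem in several variables: the absolutely monotone functions
on the negative orthant are exactly the Laplace transforms `∫ e^{s·u} dν(u)` of measures on the
closed positive orthant (`LaplaceFinite.absolutelyMonotone`, `AbsolutelyMonotone.exists_laplace`),
and `ν` is unique (`LaplaceFinite.ext`). Existence is the Hausdorff moment argument. If `T_i`
translates by `-h` in the `i`-th variable, then `T_i` and `1 - T_i` preserve absolute monotonicity,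
so the terms of the expansion of `∏ (T_i + (1 - T_i))^M` applied to `f` at a point are nonnegative
weights. Placed at the points `k/M` of the unit cube, they form a measure whose moments approximate
the values of `f` on a grid. Weak compactness produces a limit measure, and `x = e^{-u}` turns its
moments into a Laplace transform. (1) ⇒ (2): each `∂_i ψ` is the Laplace transform of some `ν_i`.
Symmetry of second derivatives and uniqueness give `u_j dν_i = u_i dν_j`, so off the origin all
`ν_i` have the form `u_i dμ` with one `μ`, and the atom of `ν_i` at the origin is the `i`-th
coordinate of `c_1`. The bound `ψ ≤ 0` makes `e^{s·u} - 1` integrable, and integrating the gradient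
leaves only the constant `c_0`. For uniqueness, `μ` is multiplied by `1 - e^{-Σ u_i}`, which makes
it finite with a Laplace transform read off from differences of `ψ`. (2) ⇒ (1): differentiation
under the integral sign shows that `∂_i ψ` is a Laplace transform. (1) ⇒ (3): for `ψ < 0` this is
the chain rule, since every derivative of the composite is a sum of products of nonnegative terms.
If `ψ` vanishes somewhere, it vanishes identically, and the boundary value `f(0, ·)` is again a
Laplace transform. (3) ⇒ (1): the test function `e^{ε x}` shows that `e^{ε ψ}` is absolutely
monotone; dividing its first derivatives by `ε` and letting `ε → 0` yields the claim for `∂_i ψ`. -/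

namespace Bernstein

/-! ### Calculus of partial derivatives on the negative orthant -/

lemma isOpen_negOrthant (n : ℕ) : IsOpen (negOrthant n) := by
  simp only [negOrthant, ofPred_forall]
  exact isOpen_iInter_of_finite fun i => isOpen_lt (continuous_apply i) continuous_const

lemma negOrthant_mem_nhds {n : ℕ} {s : Fin n → ℝ} (hs : s ∈ negOrthant n) :
    negOrthant n ∈ 𝓝 s := (isOpen_negOrthant n).mem_nhds hs

lemma convex_negOrthant (n : ℕ) : Convex ℝ (negOrthant n) := by
  have : negOrthant n = Set.pi univ fun _ => Iio (0 : ℝ) := by ext; simp [negOrthant]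
  rw [this]
  exact convex_pi fun _ _ => convex_Iio 0

lemma mem_negOrthant_of_le {n : ℕ} {s t : Fin n → ℝ} (hst : s ≤ t) (ht : t ∈ negOrthant n) :
    s ∈ negOrthant n := fun i => (hst i).trans_lt (ht i)

lemma differentiableAt_of_contDiffOn {n : ℕ} {f : (Fin n → ℝ) → ℝ}
    (hf : ContDiffOn ℝ ∞ f (negOrthant n)) {s : Fin n → ℝ} (hs : s ∈ negOrthant n) :
    DifferentiableAt ℝ f s :=
  (hf.contDiffAt (negOrthant_mem_nhds hs)).differentiableAt (by simp)

lemma partialDeriv_congr {n : ℕ} (i : Fin n) {f g : (Fin n → ℝ) → ℝ}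
    (h : EqOn f g (negOrthant n)) :
    EqOn (partialDeriv i f) (partialDeriv i g) (negOrthant n) := fun s hs => by
  rw [partialDeriv, partialDeriv, (h.eventuallyEq_of_mem (negOrthant_mem_nhds hs)).fderiv_eq]

lemma iterPartialDeriv_cons {n : ℕ} (i : Fin n) (l : List (Fin n)) (f : (Fin n → ℝ) → ℝ) :
    iterPartialDeriv (i :: l) f = partialDeriv i (iterPartialDeriv l f) := rfl

lemma iterPartialDeriv_append {n : ℕ} (l l' : List (Fin n)) (f : (Fin n → ℝ) → ℝ) :
    iterPartialDeriv (l ++ l') f = iterPartialDeriv l (iterPartialDeriv l' f) := by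
  simp [iterPartialDeriv]

lemma iterPartialDeriv_concat {n : ℕ} (l : List (Fin n)) (i : Fin n) (f : (Fin n → ℝ) → ℝ) :
    iterPartialDeriv (l ++ [i]) f = iterPartialDeriv l (partialDeriv i f) :=
  iterPartialDeriv_append l [i] f

lemma iterPartialDeriv_congr {n : ℕ} (l : List (Fin n)) {f g : (Fin n → ℝ) → ℝ}
    (h : EqOn f g (negOrthant n)) :
    EqOn (iterPartialDeriv l f) (iterPartialDeriv l g) (negOrthant n) := by
  induction l with
  | nil => exact h
  | cons i l ih => exact partialDeriv_congr i ih

lemma contDiffOn_partialDeriv {n : ℕ} (i : Fin n) {f : (Fin n → ℝ) → ℝ}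
    (hf : ContDiffOn ℝ ∞ f (negOrthant n)) :
    ContDiffOn ℝ ∞ (partialDeriv i f) (negOrthant n) :=
  (hf.fderiv_of_isOpen (isOpen_negOrthant n) (m := ∞) (by simp)).clm_apply contDiffOn_const

lemma contDiffOn_iterPartialDeriv {n : ℕ} (l : List (Fin n)) {f : (Fin n → ℝ) → ℝ}
    (hf : ContDiffOn ℝ ∞ f (negOrthant n)) :
    ContDiffOn ℝ ∞ (iterPartialDeriv l f) (negOrthant n) := by
  induction l with
  | nil => exact hf
  | cons i l ih => exact contDiffOn_partialDeriv i ih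

lemma fderiv_apply_eq_sum {n : ℕ} (f : (Fin n → ℝ) → ℝ) (s v : Fin n → ℝ) :
    fderiv ℝ f s v = ∑ i, v i * partialDeriv i f s := by
  conv_lhs => rw [pi_eq_sum_univ' v]
  simp only [map_sum, map_smul, smul_eq_mul, partialDeriv]

section Rules

variable {n : ℕ} {f g : (Fin n → ℝ) → ℝ}

lemma partialDeriv_add (i : Fin n) (hf : ContDiffOn ℝ ∞ f (negOrthant n))
    (hg : ContDiffOn ℝ ∞ g (negOrthant n)) :
    EqOn (partialDeriv i (f + g)) (partialDeriv i f + partialDeriv i g) (negOrthant n) :=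
  fun s hs => by
    simp [partialDeriv, fderiv_add (differentiableAt_of_contDiffOn hf hs)
      (differentiableAt_of_contDiffOn hg hs)]

lemma partialDeriv_sub (i : Fin n) (hf : ContDiffOn ℝ ∞ f (negOrthant n))
    (hg : ContDiffOn ℝ ∞ g (negOrthant n)) :
    EqOn (partialDeriv i (f - g)) (partialDeriv i f - partialDeriv i g) (negOrthant n) :=
  fun s hs => by
    simp [partialDeriv, fderiv_sub (differentiableAt_of_contDiffOn hf hs)
      (differentiableAt_of_contDiffOn hg hs)]

lemma partialDeriv_mul (i : Fin n) (hf : ContDiffOn ℝ ∞ f (negOrthant n))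
    (hg : ContDiffOn ℝ ∞ g (negOrthant n)) :
    EqOn (partialDeriv i (f * g)) (f * partialDeriv i g + g * partialDeriv i f) (negOrthant n) :=
  fun s hs => by
    simp [partialDeriv, fderiv_mul (differentiableAt_of_contDiffOn hf hs)
      (differentiableAt_of_contDiffOn hg hs)]

lemma partialDeriv_smul (i : Fin n) (c : ℝ) (hf : ContDiffOn ℝ ∞ f (negOrthant n)) :
    EqOn (partialDeriv i (c • f)) (c • partialDeriv i f) (negOrthant n) :=
  fun s hs => by
    simp [partialDeriv, fderiv_const_smul (differentiableAt_of_contDiffOn hf hs)]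

lemma iterPartialDeriv_add (l : List (Fin n)) (hf : ContDiffOn ℝ ∞ f (negOrthant n))
    (hg : ContDiffOn ℝ ∞ g (negOrthant n)) :
    EqOn (iterPartialDeriv l (f + g)) (iterPartialDeriv l f + iterPartialDeriv l g)
      (negOrthant n) := by
  induction l with
  | nil => exact eqOn_refl _ _
  | cons i l ih =>
    exact (partialDeriv_congr i ih).trans (partialDeriv_add i (contDiffOn_iterPartialDeriv l hf)
      (contDiffOn_iterPartialDeriv l hg))

lemma iterPartialDeriv_sub (l : List (Fin n)) (hf : ContDiffOn ℝ ∞ f (negOrthant n))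
    (hg : ContDiffOn ℝ ∞ g (negOrthant n)) :
    EqOn (iterPartialDeriv l (f - g)) (iterPartialDeriv l f - iterPartialDeriv l g)
      (negOrthant n) := by
  induction l with
  | nil => exact eqOn_refl _ _
  | cons i l ih =>
    exact (partialDeriv_congr i ih).trans (partialDeriv_sub i (contDiffOn_iterPartialDeriv l hf)
      (contDiffOn_iterPartialDeriv l hg))

lemma iterPartialDeriv_smul (l : List (Fin n)) (c : ℝ) (hf : ContDiffOn ℝ ∞ f (negOrthant n)) :
    EqOn (iterPartialDeriv l (c • f)) (c • iterPartialDeriv l f) (negOrthant n) := by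
  induction l with
  | nil => exact eqOn_refl _ _
  | cons i l ih =>
    exact (partialDeriv_congr i ih).trans (partialDeriv_smul i c (contDiffOn_iterPartialDeriv l hf))

end Rules

/-! ### Absolute monotonicity up to a finite order and closure properties -/

/-- `f` is smooth on the negative orthant and its partial derivatives of order at most `N` are
nonnegative there. -/
def AbsolutelyMonotoneUpTo {n : ℕ} (N : ℕ) (f : (Fin n → ℝ) → ℝ) : Prop :=
  ContDiffOn ℝ ∞ f (negOrthant n) ∧
    ∀ l : List (Fin n), l.length ≤ N → ∀ s ∈ negOrthant n, 0 ≤ iterPartialDeriv l f s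

section UpTo

variable {n N : ℕ} {f g : (Fin n → ℝ) → ℝ}

lemma absolutelyMonotone_iff_forall_upTo :
    AbsolutelyMonotone f ↔ ∀ N, AbsolutelyMonotoneUpTo N f :=
  ⟨fun h _ => ⟨h.1, fun l _ => h.2 l⟩, fun h => ⟨(h 0).1, fun l => (h l.length).2 l le_rfl⟩⟩

lemma AbsolutelyMonotone.upTo (hf : AbsolutelyMonotone f) (N : ℕ) : AbsolutelyMonotoneUpTo N f :=
  absolutelyMonotone_iff_forall_upTo.1 hf N

lemma absolutelyMonotoneUpTo_zero_iff :
    AbsolutelyMonotoneUpTo 0 f ↔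
      ContDiffOn ℝ ∞ f (negOrthant n) ∧ ∀ s ∈ negOrthant n, 0 ≤ f s := by
  refine ⟨fun h => ⟨h.1, h.2 [] le_rfl⟩, fun h => ⟨h.1, fun l hl => ?_⟩⟩
  obtain rfl : l = [] := by simpa using hl
  exact h.2

/-- The derivative taken first is the last entry of the list, so that entry is peeled off. This form
suits inductions in which `∂_i f` is given by a formula, such as the product or chain rule. -/
lemma absolutelyMonotoneUpTo_succ_iff :
    AbsolutelyMonotoneUpTo (N + 1) f ↔
      ContDiffOn ℝ ∞ f (negOrthant n) ∧ (∀ s ∈ negOrthant n, 0 ≤ f s) ∧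
        ∀ i, AbsolutelyMonotoneUpTo N (partialDeriv i f) := by
  constructor
  · refine fun h => ⟨h.1, h.2 [] (by simp), fun i => ⟨contDiffOn_partialDeriv i h.1, ?_⟩⟩
    intro l hl
    rw [← iterPartialDeriv_concat]
    exact h.2 _ (by simpa using hl)
  · refine fun h => ⟨h.1, fun l hl => ?_⟩
    rcases List.eq_nil_or_concat l with rfl | ⟨l, i, rfl⟩
    · exact h.2.1
    · rw [List.concat_eq_append, iterPartialDeriv_concat]
      exact (h.2.2 i).2 l (by simpa using hl)

lemma AbsolutelyMonotoneUpTo.mono {M : ℕ} (hf : AbsolutelyMonotoneUpTo N f) (h : M ≤ N) :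
    AbsolutelyMonotoneUpTo M f :=
  ⟨hf.1, fun l hl => hf.2 l (hl.trans h)⟩

lemma AbsolutelyMonotoneUpTo.congr (hf : AbsolutelyMonotoneUpTo N f)
    (h : EqOn g f (negOrthant n)) : AbsolutelyMonotoneUpTo N g :=
  ⟨hf.1.congr h, fun l hl s hs => by
    rw [iterPartialDeriv_congr l h hs]
    exact hf.2 l hl s hs⟩

lemma AbsolutelyMonotoneUpTo.add (hf : AbsolutelyMonotoneUpTo N f)
    (hg : AbsolutelyMonotoneUpTo N g) : AbsolutelyMonotoneUpTo N (f + g) :=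
  ⟨hf.1.add hg.1, fun l hl s hs => by
    rw [iterPartialDeriv_add l hf.1 hg.1 hs]
    exact add_nonneg (hf.2 l hl s hs) (hg.2 l hl s hs)⟩

/-- Leibniz rule and induction on the order: each product in the derivative needs only order `N`,
and there one factor is a derivative and the other is undifferentiated. -/
lemma AbsolutelyMonotoneUpTo.mul (hf : AbsolutelyMonotoneUpTo N f)
    (hg : AbsolutelyMonotoneUpTo N g) : AbsolutelyMonotoneUpTo N (f * g) := by
  induction N generalizing f g with
  | zero =>
    rw [absolutelyMonotoneUpTo_zero_iff] at *
    exact ⟨hf.1.mul hg.1, fun s hs => mul_nonneg (hf.2 s hs) (hg.2 s hs)⟩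
  | succ N ih =>
    have hf' := absolutelyMonotoneUpTo_succ_iff.1 hf
    have hg' := absolutelyMonotoneUpTo_succ_iff.1 hg
    refine absolutelyMonotoneUpTo_succ_iff.2
      ⟨hf.1.mul hg.1, fun s hs => mul_nonneg (hf'.2.1 s hs) (hg'.2.1 s hs), fun i => ?_⟩
    exact ((ih (hf.mono N.le_succ) (hg'.2.2 i)).add
      (ih (hg.mono N.le_succ) (hf'.2.2 i))).congr (partialDeriv_mul i hf.1 hg.1)

end UpTo

section Basic

variable {n : ℕ} {f g : (Fin n → ℝ) → ℝ}

lemma AbsolutelyMonotone.congr (hf : AbsolutelyMonotone f) (h : EqOn g f (negOrthant n)) :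
    AbsolutelyMonotone g :=
  absolutelyMonotone_iff_forall_upTo.2 fun N => (hf.upTo N).congr h

lemma AbsolutelyMonotone.nonneg (hf : AbsolutelyMonotone f) {s : Fin n → ℝ}
    (hs : s ∈ negOrthant n) : 0 ≤ f s := hf.2 [] s hs

lemma AbsolutelyMonotone.iterPartialDeriv (hf : AbsolutelyMonotone f) (l : List (Fin n)) :
    AbsolutelyMonotone (iterPartialDeriv l f) :=
  ⟨contDiffOn_iterPartialDeriv l hf.1, fun l' => by
    rw [← iterPartialDeriv_append]
    exact hf.2 _⟩

lemma AbsolutelyMonotone.partialDeriv (hf : AbsolutelyMonotone f) (i : Fin n) :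
    AbsolutelyMonotone (partialDeriv i f) := hf.iterPartialDeriv [i]

lemma monotoneOn_of_partialDeriv_nonneg (hf : ContDiffOn ℝ ∞ f (negOrthant n))
    (h : ∀ i, ∀ s ∈ negOrthant n, 0 ≤ partialDeriv i f s) : MonotoneOn f (negOrthant n) := by
  intro s hs t ht hst
  obtain ⟨z, hz, hz'⟩ := domain_mvt
    (fun x hx => ((differentiableAt_of_contDiffOn hf hx).hasFDerivAt).hasFDerivWithinAt)
    (convex_negOrthant n) hs ht
  rw [← sub_nonneg, hz', fderiv_apply_eq_sum]
  exact Finset.sum_nonneg fun i _ => mul_nonneg (sub_nonneg.2 (hst i))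
    (h i z ((convex_negOrthant n).segment_subset hs ht hz))

lemma AbsolutelyMonotone.monotoneOn (hf : AbsolutelyMonotone f) : MonotoneOn f (negOrthant n) :=
  monotoneOn_of_partialDeriv_nonneg hf.1 fun i => hf.2 [i]

lemma iterPartialDeriv_comp_sub (l : List (Fin n)) (t : Fin n → ℝ) :
    iterPartialDeriv l (fun s => f (s - t)) = fun s => iterPartialDeriv l f (s - t) := by
  induction l with
  | nil => rfl
  | cons i l ih =>
    rw [iterPartialDeriv_cons, ih]
    funext s
    simp [partialDeriv, fderiv_comp_sub, iterPartialDeriv_cons]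

lemma sub_mem_negOrthant {s t : Fin n → ℝ} (hs : s ∈ negOrthant n) (ht : 0 ≤ t) :
    s - t ∈ negOrthant n := mem_negOrthant_of_le (sub_le_self s ht) hs

lemma AbsolutelyMonotone.comp_sub (hf : AbsolutelyMonotone f) {t : Fin n → ℝ} (ht : 0 ≤ t) :
    AbsolutelyMonotone fun s => f (s - t) :=
  ⟨hf.1.comp (by fun_prop) fun _ hs => sub_mem_negOrthant hs ht, fun l s hs => by
    rw [iterPartialDeriv_comp_sub]
    exact hf.2 l _ (sub_mem_negOrthant hs ht)⟩

/-- Every iterated derivative of `f` is again absolutely monotone, hence monotone, so its increments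
are nonnegative. Iterating this makes all higher differences nonnegative. -/
lemma AbsolutelyMonotone.sub_comp_sub (hf : AbsolutelyMonotone f) {t : Fin n → ℝ} (ht : 0 ≤ t) :
    AbsolutelyMonotone (f - fun s => f (s - t)) :=
  ⟨hf.1.sub (hf.comp_sub ht).1, fun l s hs => by
    rw [iterPartialDeriv_sub l hf.1 (hf.comp_sub ht).1 hs, iterPartialDeriv_comp_sub]
    exact sub_nonneg.2 ((hf.iterPartialDeriv l).monotoneOn (sub_mem_negOrthant hs ht) hs
      (sub_le_self s ht))⟩

end Basic

/-! ### Laplace transforms of measures on the closed positive orthant -/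

section Laplace

variable {n : ℕ}

@[fun_prop]
lemma continuous_dotProduct_left (s : Fin n → ℝ) : Continuous fun u : Fin n → ℝ => s ⬝ᵥ u := by
  unfold dotProduct
  fun_prop

@[fun_prop]
lemma measurable_dotProduct_left (s : Fin n → ℝ) : Measurable fun u : Fin n → ℝ => s ⬝ᵥ u :=
  (continuous_dotProduct_left s).measurable

lemma dotProduct_mono_left {s t u : Fin n → ℝ} (hst : s ≤ t) (hu : 0 ≤ u) :
    s ⬝ᵥ u ≤ t ⬝ᵥ u :=
  Finset.sum_le_sum fun i _ => mul_le_mul_of_nonneg_right (hst i) (hu i)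

lemma mul_single_le_neg_dotProduct {s u : Fin n → ℝ} (hs : s ≤ 0) (hu : 0 ≤ u) (j : Fin n) :
    -s j * u j ≤ -(s ⬝ᵥ u) := by
  rw [← neg_dotProduct]
  exact Finset.single_le_sum (f := fun i => -s i * u i)
    (fun i _ => mul_nonneg (neg_nonneg.2 (hs i)) (hu i)) (Finset.mem_univ j)

lemma dotProduct_nonpos_of_nonpos {s u : Fin n → ℝ} (hs : s ≤ 0) (hu : 0 ≤ u) :
    s ⬝ᵥ u ≤ 0 := by
  simpa using dotProduct_mono_left hs hu

lemma negOrthant_nonpos {s : Fin n → ℝ} (hs : s ∈ negOrthant n) : s ≤ 0 := fun i => (hs i).le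

/-- The negative orthant contains a translate upwards of each of its points. -/
lemma exists_add_mem_negOrthant {s : Fin n → ℝ} (hs : s ∈ negOrthant n) :
    ∃ ε > 0, s + (fun _ => ε) ∈ negOrthant n := by
  have h : Tendsto (fun ε : ℝ => s + fun _ => ε) (𝓝[>] 0) (𝓝 s) := by
    have : Continuous fun ε : ℝ => s + fun _ : Fin n => ε := by fun_prop
    have h0 := this.tendsto 0
    simp only [show (s + fun _ : Fin n => (0 : ℝ)) = s from add_zero s] at h0
    exact h0.mono_left nhdsWithin_le_nhds
  obtain ⟨ε, h1, h2⟩ := ((h.eventually (negOrthant_mem_nhds hs)).and self_mem_nhdsWithin).exists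
  exact ⟨ε, h2, h1⟩

lemma hasFDerivAt_dotProduct_left (u s : Fin n → ℝ) :
    HasFDerivAt (fun s : Fin n → ℝ => s ⬝ᵥ u)
      (∑ i, u i • ContinuousLinearMap.proj (R := ℝ) (φ := fun _ : Fin n => ℝ) i) s := by
  unfold dotProduct
  exact HasFDerivAt.fun_sum fun i _ => (hasFDerivAt_apply i s).mul_const (u i)

lemma sum_smul_proj_apply (c v : Fin n → ℝ) :
    (∑ j, c j • ContinuousLinearMap.proj (R := ℝ) (φ := fun _ : Fin n => ℝ) j) v
      = ∑ j, c j * v j := by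
  simp

/-- Differentiation under the integral sign for `s ↦ ∫ (e^{s · u} - b) dμ(u)`. -/
lemma hasFDerivAt_integral_exp_sub {μ : Measure (Fin n → ℝ)} (b : ℝ) (hμ : ∀ᵐ u ∂μ, 0 ≤ u)
    (hint : ∀ s ∈ negOrthant n, Integrable (fun u => Real.exp (s ⬝ᵥ u) - b) μ)
    (hint' : ∀ i, ∀ s ∈ negOrthant n, Integrable (fun u => u i * Real.exp (s ⬝ᵥ u)) μ)
    {s : Fin n → ℝ} (hs : s ∈ negOrthant n) :
    HasFDerivAt (fun s => ∫ u, (Real.exp (s ⬝ᵥ u) - b) ∂μ)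
      (∑ i, (∫ u, u i * Real.exp (s ⬝ᵥ u) ∂μ) •
        ContinuousLinearMap.proj (R := ℝ) (φ := fun _ : Fin n => ℝ) i) s := by
  -- In the sup norm, every point of the ball of radius `ε` about `s` lies below the corner `s + ε`,
  -- still in the orthant. As `u ≥ 0`, the exponential at this corner dominates on the whole ball.
  obtain ⟨ε, hε, hsε⟩ := exists_add_mem_negOrthant hs
  set L : (Fin n → ℝ) → ((Fin n → ℝ) →L[ℝ] ℝ) := fun u =>
    ∑ i, u i • ContinuousLinearMap.proj (R := ℝ) (φ := fun _ : Fin n => ℝ) i with hL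
  have hLc : Continuous L := by fun_prop
  have hLn : ∀ u : Fin n → ℝ, 0 ≤ u → ‖L u‖ ≤ ∑ i, u i := fun u hu => by
    refine (norm_sum_le _ _).trans (Finset.sum_le_sum fun i _ => ?_)
    rw [norm_smul, Real.norm_of_nonneg (hu i)]
    refine mul_le_of_le_one_right (hu i)
      (ContinuousLinearMap.opNorm_le_bound _ zero_le_one fun v => ?_)
    simpa using norm_le_pi_norm v i
  have key := hasFDerivAt_integral_of_dominated_of_fderiv_le (𝕜 := ℝ) (μ := μ)
    (F := fun s u => Real.exp (s ⬝ᵥ u) - b) (F' := fun s u => Real.exp (s ⬝ᵥ u) • L u)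
    (bound := fun u => ∑ i, u i * Real.exp ((s + fun _ => ε) ⬝ᵥ u)) (x₀ := s)
    (Metric.ball_mem_nhds s hε)
    (Eventually.of_forall fun s => by
      have : Continuous fun u : Fin n → ℝ => Real.exp (s ⬝ᵥ u) - b := by fun_prop
      exact this.aestronglyMeasurable)
    (hint s hs)
    (by
      have : Continuous fun u : Fin n → ℝ => Real.exp (s ⬝ᵥ u) • L u := by fun_prop
      exact this.aestronglyMeasurable)
    (by
      filter_upwards [hμ] with u hu x hx
      rw [norm_smul, Real.norm_of_nonneg (Real.exp_pos _).le, ← Finset.sum_mul, mul_comm]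
      have hx' : x ≤ s + fun _ => ε := fun i => by
        have := (norm_le_pi_norm (x - s) i).trans_lt (by simpa [dist_eq_norm] using hx)
        have := (le_abs_self _).trans_lt this
        simp only [Pi.sub_apply, Pi.add_apply] at this ⊢
        linarith
      exact mul_le_mul (hLn u hu) (Real.exp_le_exp.2 (dotProduct_mono_left hx' hu))
        (Real.exp_pos _).le (Finset.sum_nonneg fun i _ => hu i))
    (integrable_finsetSum _ fun i _ => hint' i _ hsε)
    (Eventually.of_forall fun u x _ => ((hasFDerivAt_dotProduct_left u x).exp).sub_const b)
  refine key.congr_fderiv (Eq.symm ?_)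
  refine ContinuousLinearMap.ext fun v => ?_
  have hI : Integrable (fun u => Real.exp (s ⬝ᵥ u) • L u) μ := by
    have hc : Continuous fun u : Fin n → ℝ => Real.exp (s ⬝ᵥ u) • L u := by fun_prop
    refine Integrable.mono' (g := fun u => ∑ i, u i * Real.exp (s ⬝ᵥ u))
      (integrable_finsetSum _ fun i _ => hint' i s hs)
      hc.aestronglyMeasurable ?_
    filter_upwards [hμ] with u hu
    rw [norm_smul, Real.norm_of_nonneg (Real.exp_pos _).le, ← Finset.sum_mul, mul_comm]
    exact mul_le_mul_of_nonneg_right (hLn u hu) (Real.exp_pos _).le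
  have hIv := ContinuousLinearMap.integral_apply (μ := μ)
    (φ := fun u => Real.exp (s ⬝ᵥ u) • L u) hI v
  refine Eq.trans ?_ hIv.symm
  rw [sum_smul_proj_apply]
  have hLv : ∀ u, (Real.exp (s ⬝ᵥ u) • L u) v = ∑ i, u i * Real.exp (s ⬝ᵥ u) * v i := fun u => by
    rw [smul_apply, hL, sum_smul_proj_apply, smul_eq_mul, Finset.mul_sum]
    exact Finset.sum_congr rfl fun i _ => by ring
  simp only [hLv]
  rw [integral_finsetSum _ fun i _ => (hint' i s hs).mul_const (v i)]
  exact Finset.sum_congr rfl fun i _ => (integral_mul_const _ _).symm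

/-- A measure on the closed positive orthant with a finite Laplace transform on the negative
orthant. -/
structure LaplaceFinite (ν : Measure (Fin n → ℝ)) : Prop where
  nonneg : ∀ᵐ u ∂ν, 0 ≤ u
  integrable : ∀ s ∈ negOrthant n, Integrable (fun u => Real.exp (s ⬝ᵥ u)) ν

/-- The Laplace transform `s ↦ ∫ e^{s · u} dν(u)`. -/
noncomputable def laplace (ν : Measure (Fin n → ℝ)) (s : Fin n → ℝ) : ℝ :=
  ∫ u, Real.exp (s ⬝ᵥ u) ∂ν

/-- The measure `u_i dν(u)`. -/
noncomputable def coordMeasure (ν : Measure (Fin n → ℝ)) (i : Fin n) : Measure (Fin n → ℝ) :=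
  ν.withDensity fun u => ENNReal.ofReal (u i)

lemma LaplaceFinite.of_integrable_coord {ν : Measure (Fin n → ℝ)} (hν : ∀ᵐ u ∂ν, 0 ≤ u)
    {i : Fin n} (h : ∀ s ∈ negOrthant n, Integrable (fun u => u i * Real.exp (s ⬝ᵥ u)) ν) :
    LaplaceFinite (coordMeasure ν i) := by
  refine ⟨(withDensity_absolutelyContinuous _ _).ae_le hν, fun s hs => ?_⟩
  rw [coordMeasure, integrable_withDensity_iff (by fun_prop)
    (Eventually.of_forall fun _ => ENNReal.ofReal_lt_top)]
  refine (h s hs).congr ?_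
  filter_upwards [hν] with u hu
  rw [ENNReal.toReal_ofReal (hu i), mul_comm]

lemma laplace_coordMeasure {ν : Measure (Fin n → ℝ)} (hν : ∀ᵐ u ∂ν, 0 ≤ u) (i : Fin n)
    (s : Fin n → ℝ) : laplace (coordMeasure ν i) s = ∫ u, u i * Real.exp (s ⬝ᵥ u) ∂ν := by
  rw [laplace, coordMeasure, integral_withDensity_eq_integral_toReal_smul (by fun_prop)
    (Eventually.of_forall fun _ => ENNReal.ofReal_lt_top)]
  refine integral_congr_ae ?_
  filter_upwards [hν] with u hu
  rw [ENNReal.toReal_ofReal (hu i), smul_eq_mul]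

variable {ν : Measure (Fin n → ℝ)}

/-- There is room to increase `s` slightly: `ε u_i ≤ e^{ε Σ u_j}`, so the factor `u_i` is absorbed
by the exponential at `s + ε`. -/
lemma LaplaceFinite.integrable_coord_mul (hν : LaplaceFinite ν) (i : Fin n) {s : Fin n → ℝ}
    (hs : s ∈ negOrthant n) : Integrable (fun u => u i * Real.exp (s ⬝ᵥ u)) ν := by
  obtain ⟨ε, hε, hsε⟩ := exists_add_mem_negOrthant hs
  have hm : Continuous fun u : Fin n → ℝ => u i * Real.exp (s ⬝ᵥ u) := by fun_prop
  refine Integrable.mono' ((hν.integrable _ hsε).const_mul ε⁻¹) hm.aestronglyMeasurable ?_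
  filter_upwards [hν.nonneg] with u hu
  rw [Real.norm_of_nonneg (mul_nonneg (hu i) (Real.exp_pos _).le), add_dotProduct, add_comm,
    Real.exp_add, ← mul_assoc]
  refine mul_le_mul_of_nonneg_right ?_ (Real.exp_pos _).le
  rw [inv_mul_eq_div, le_div_iff₀ hε]
  have h1 : u i * ε ≤ (fun _ => ε) ⬝ᵥ u := by
    rw [mul_comm]
    exact Finset.single_le_sum (f := fun i => ε * u i)
      (fun i _ => mul_nonneg hε.le (hu i)) (Finset.mem_univ i)
  linarith [Real.add_one_le_exp ((fun _ => ε) ⬝ᵥ u)]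

lemma LaplaceFinite.coordMeasure (hν : LaplaceFinite ν) (i : Fin n) :
    LaplaceFinite (coordMeasure ν i) :=
  .of_integrable_coord hν.nonneg fun _ hs => hν.integrable_coord_mul i hs

lemma LaplaceFinite.hasFDerivAt (hν : LaplaceFinite ν) {s : Fin n → ℝ} (hs : s ∈ negOrthant n) :
    HasFDerivAt (laplace ν) (∑ i, laplace (Bernstein.coordMeasure ν i) s •
      ContinuousLinearMap.proj (R := ℝ) (φ := fun _ : Fin n => ℝ) i) s := by
  have h := hasFDerivAt_integral_exp_sub 0 hν.nonneg (by simpa using hν.integrable)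
    (fun i s hs => hν.integrable_coord_mul i hs) hs
  simp only [sub_zero, ← laplace_coordMeasure hν.nonneg] at h
  exact h

lemma sum_smul_proj_apply_single (c : Fin n → ℝ) (i : Fin n) :
    (∑ j, c j • ContinuousLinearMap.proj (R := ℝ) (φ := fun _ : Fin n => ℝ) j) (Pi.single i 1)
      = c i := by
  simp [Pi.single_apply]

lemma LaplaceFinite.partialDeriv_eq (hν : LaplaceFinite ν) (i : Fin n) :
    EqOn (partialDeriv i (laplace ν)) (laplace (Bernstein.coordMeasure ν i)) (negOrthant n) :=
  fun s hs => by
    rw [partialDeriv, (hν.hasFDerivAt hs).fderiv, sum_smul_proj_apply_single]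

/-- The bootstrap step for smoothness: the gradient of a Laplace transform consists of Laplace
transforms, so regularity rises by one order at a time. -/
lemma contDiffOn_of_hasFDerivAt_sum {f : (Fin n → ℝ) → ℝ} {g : Fin n → (Fin n → ℝ) → ℝ} {k : ℕ}
    (hf : ∀ s ∈ negOrthant n, HasFDerivAt f (∑ i, g i s •
      ContinuousLinearMap.proj (R := ℝ) (φ := fun _ : Fin n => ℝ) i) s)
    (hg : ∀ i, ContDiffOn ℝ k (g i) (negOrthant n)) : ContDiffOn ℝ (k + 1) f (negOrthant n) := by
  rw [contDiffOn_succ_iff_fderiv_of_isOpen (isOpen_negOrthant n)]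
  refine ⟨fun s hs => (hf s hs).differentiableAt.differentiableWithinAt,
    fun h => by simp at h, ?_⟩
  have : ContDiffOn ℝ k (fun s => ∑ i, g i s •
      ContinuousLinearMap.proj (R := ℝ) (φ := fun _ : Fin n => ℝ) i) (negOrthant n) :=
    ContDiffOn.sum fun i _ => (hg i).smul contDiffOn_const
  exact this.congr fun s hs => (hf s hs).fderiv

lemma LaplaceFinite.contDiffOn (hν : LaplaceFinite ν) :
    ContDiffOn ℝ ∞ (laplace ν) (negOrthant n) := by
  refine contDiffOn_infty.2 fun k => ?_
  induction k generalizing ν with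
  | zero =>
    exact contDiffOn_zero.2 fun s hs => (hν.hasFDerivAt hs).continuousAt.continuousWithinAt
  | succ k ih =>
    exact contDiffOn_of_hasFDerivAt_sum (fun s hs => hν.hasFDerivAt hs)
      fun i => ih (hν.coordMeasure i)

/-- Laplace transforms are absolutely monotone. -/
theorem LaplaceFinite.absolutelyMonotone (hν : LaplaceFinite ν) :
    AbsolutelyMonotone (laplace ν) := by
  have h0 : ∀ {ν : Measure (Fin n → ℝ)}, ∀ s ∈ negOrthant n, 0 ≤ laplace ν s :=
    fun s _ => integral_nonneg fun u => (Real.exp_pos _).le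
  refine absolutelyMonotone_iff_forall_upTo.2 fun N => ?_
  induction N generalizing ν with
  | zero => exact absolutelyMonotoneUpTo_zero_iff.2 ⟨hν.contDiffOn, h0⟩
  | succ N ih =>
    exact absolutelyMonotoneUpTo_succ_iff.2 ⟨hν.contDiffOn, h0, fun i =>
      (ih (hν.coordMeasure i)).congr (hν.partialDeriv_eq i)⟩

lemma laplace_add_measure {ν ν' : Measure (Fin n → ℝ)} (hν : LaplaceFinite ν)
    (hν' : LaplaceFinite ν') {s : Fin n → ℝ} (hs : s ∈ negOrthant n) :
    laplace (ν + ν') s = laplace ν s + laplace ν' s :=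
  integral_add_measure (hν.integrable s hs) (hν'.integrable s hs)

lemma LaplaceFinite.add {ν ν' : Measure (Fin n → ℝ)} (hν : LaplaceFinite ν)
    (hν' : LaplaceFinite ν') : LaplaceFinite (ν + ν') :=
  ⟨ae_add_measure_iff.2 ⟨hν.nonneg, hν'.nonneg⟩,
    fun s hs => (hν.integrable s hs).add_measure (hν'.integrable s hs)⟩

end Laplace

/-! ### Uniqueness of the Laplace transform through moments on the unit cube -/

variable {n : ℕ}

lemma continuous_coe_apply (i : Fin n) : Continuous fun x : Fin n → unitInterval => (x i : ℝ) := by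
  fun_prop

/-- A finite measure on the unit cube is determined by its moments. -/
theorem ext_of_moments {P Q : Measure (Fin n → unitInterval)} [IsFiniteMeasure P]
    [IsFiniteMeasure Q]
    (h : ∀ m : Fin n → ℕ, ∫ x, ∏ i, (x i : ℝ) ^ m i ∂P = ∫ x, ∏ i, (x i : ℝ) ^ m i ∂Q) :
    P = Q := by
  let c : Fin n → BoundedContinuousFunction (Fin n → unitInterval) ℝ := fun i =>
    BoundedContinuousFunction.mkOfCompact ⟨_, continuous_coe_apply i⟩
  let Φ := MvPolynomial.aeval (R := ℝ) c
  have hΦ : ∀ p x, Φ p x = MvPolynomial.eval (fun i => (x i : ℝ)) p := fun p x => by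
    induction p using MvPolynomial.induction_on with
    | C a => simp [Φ]
    | add p q hp hq => simp [hp, hq]
    | mul_X p i hp => simp only [map_mul, BoundedContinuousFunction.coe_mul, Pi.mul_apply, hp,
        MvPolynomial.eval_X]; simp [Φ, c]
  -- The polynomial functions on the cube. They separate points through the coordinates, so their
  -- integrals determine a finite measure, and these integrals are combinations of moments.
  let A : StarSubalgebra ℝ (BoundedContinuousFunction (Fin n → unitInterval) ℝ) :=
    { Φ.range with
      star_mem' := fun {a} ha => by
        have : star a = a := by ext; simp
        rw [this]
        exact ha }
  refine ext_of_forall_mem_subalgebra_integral_eq_of_polish (𝕜 := ℝ) (A := A) ?_ ?_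
  · intro x y hxy
    obtain ⟨i, hi⟩ := Function.ne_iff.1 hxy
    refine ⟨_, ⟨(c i).toContinuousMap, ⟨c i, ⟨MvPolynomial.X i, ?_⟩, rfl⟩, rfl⟩, ?_⟩
    · simp [Φ]
    · simpa [c, Subtype.ext_iff] using hi
  · rintro g ⟨p, rfl⟩
    have hint : ∀ (ρ : Measure (Fin n → unitInterval)) [IsFiniteMeasure ρ] (d : Fin n →₀ ℕ),
        Integrable (fun x : Fin n → unitInterval => ∏ i, (x i : ℝ) ^ d i) ρ := fun ρ _ d => by
      have : Continuous fun x : Fin n → unitInterval => ∏ i, (x i : ℝ) ^ d i := by fun_prop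
      exact this.integrable_of_hasCompactSupport (HasCompactSupport.of_compactSpace _)
    have hexp : ∀ (ρ : Measure (Fin n → unitInterval)) [IsFiniteMeasure ρ],
        ∫ x, Φ p x ∂ρ = ∑ d ∈ p.support, p.coeff d * ∫ x, ∏ i, (x i : ℝ) ^ d i ∂ρ := fun ρ _ => by
      simp only [hΦ, MvPolynomial.eval_eq']
      rw [integral_finsetSum _ fun d _ => (hint ρ d).const_mul _]
      simp only [integral_const_mul]
    refine (hexp P).trans (Eq.trans ?_ (hexp Q).symm)
    exact Finset.sum_congr rfl fun d _ => by rw [h d]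

/-- The map `u ↦ (e^{-|u_i|})_i` into the unit cube. -/
noncomputable def expNeg (u : Fin n → ℝ) (i : Fin n) : unitInterval :=
  ⟨Real.exp (-|u i|), (Real.exp_pos _).le, Real.exp_le_one_iff.2 (neg_nonpos.2 (abs_nonneg _))⟩

/-- The map `x ↦ (-log x_i)_i` from the unit cube. -/
noncomputable def negLog (x : Fin n → unitInterval) (i : Fin n) : ℝ := -Real.log (x i)

lemma measurable_expNeg : Measurable (expNeg (n := n)) := by
  refine measurable_pi_lambda _ fun i => Measurable.subtype_mk ?_
  have : Continuous fun u : Fin n → ℝ => Real.exp (-|u i|) := by fun_prop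
  exact this.measurable

lemma measurable_negLog : Measurable (negLog (n := n)) :=
  measurable_pi_lambda _ fun i =>
    (Real.measurable_log.comp (continuous_coe_apply i).measurable).neg

/-- Allows a measure on the closed positive orthant to be moved to the cube and back without loss;
the absolute value in `expNeg` is harmless there. -/
lemma negLog_expNeg {u : Fin n → ℝ} (hu : 0 ≤ u) : negLog (expNeg u) = u := by
  funext i
  simp [negLog, expNeg, abs_of_nonneg (hu i)]

lemma negLog_nonneg (x : Fin n → unitInterval) : 0 ≤ negLog x := fun i =>
  neg_nonneg.2 (Real.log_nonpos (x i).2.1 (x i).2.2)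

lemma prod_expNeg_pow {u : Fin n → ℝ} (hu : 0 ≤ u) (m : Fin n → ℕ) :
    ∏ i, (expNeg u i : ℝ) ^ m i = Real.exp ((fun i => -(m i : ℝ)) ⬝ᵥ u) := by
  rw [dotProduct, Real.exp_sum]
  refine Finset.prod_congr rfl fun i _ => ?_
  rw [expNeg, ← Real.exp_nat_mul, abs_of_nonneg (hu i)]
  congr 1
  ring

/-- The measure `e^{s · u} dν(u)`. -/
noncomputable def expTilt (ν : Measure (Fin n → ℝ)) (s : Fin n → ℝ) : Measure (Fin n → ℝ) :=
  ν.withDensity fun u => ENNReal.ofReal (Real.exp (s ⬝ᵥ u))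

lemma expTilt_ae_nonneg {ν : Measure (Fin n → ℝ)} (hν : ∀ᵐ u ∂ν, 0 ≤ u) (s : Fin n → ℝ) :
    ∀ᵐ u ∂expTilt ν s, 0 ≤ u :=
  (withDensity_absolutelyContinuous _ _).ae_le hν

lemma integral_exp_expTilt (ν : Measure (Fin n → ℝ)) (s t : Fin n → ℝ) :
    ∫ u, Real.exp (t ⬝ᵥ u) ∂expTilt ν s = ∫ u, Real.exp ((s + t) ⬝ᵥ u) ∂ν := by
  rw [expTilt, integral_withDensity_eq_integral_toReal_smul (by fun_prop)
    (Eventually.of_forall fun _ => ENNReal.ofReal_lt_top)]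
  refine integral_congr_ae (Eventually.of_forall fun u => ?_)
  simp only [smul_eq_mul]
  rw [ENNReal.toReal_ofReal (Real.exp_pos _).le, add_dotProduct, Real.exp_add]

lemma integrable_exp_expTilt {ν : Measure (Fin n → ℝ)} {s t : Fin n → ℝ} :
    Integrable (fun u => Real.exp (t ⬝ᵥ u)) (expTilt ν s) ↔
      Integrable (fun u => Real.exp ((s + t) ⬝ᵥ u)) ν := by
  rw [expTilt, integrable_withDensity_iff (by fun_prop)
    (Eventually.of_forall fun _ => ENNReal.ofReal_lt_top)]
  refine integrable_congr (Eventually.of_forall fun u => ?_)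
  simp only
  rw [ENNReal.toReal_ofReal (Real.exp_pos _).le, add_dotProduct, Real.exp_add, mul_comm]

lemma expTilt_expTilt (ν : Measure (Fin n → ℝ)) (s t : Fin n → ℝ) :
    expTilt (expTilt ν s) t = expTilt ν (s + t) := by
  rw [expTilt, expTilt, ← withDensity_mul _ (by fun_prop) (by fun_prop), expTilt]
  congr 1
  ext u
  simp only [Pi.mul_apply]
  rw [← ENNReal.ofReal_mul (Real.exp_pos _).le, add_dotProduct, Real.exp_add]

lemma expTilt_zero (ν : Measure (Fin n → ℝ)) : expTilt ν 0 = ν := by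
  simp [expTilt]

lemma isFiniteMeasure_expTilt {ν : Measure (Fin n → ℝ)} {s : Fin n → ℝ}
    (h : Integrable (fun u => Real.exp (s ⬝ᵥ u)) ν) : IsFiniteMeasure (expTilt ν s) :=
  isFiniteMeasure_withDensity_ofReal h.2

/-- A finite measure on the closed positive orthant is determined by the values of its Laplace
transform at the points of `-ℕ^n`. -/
lemma ext_of_laplace_neg_nat {P Q : Measure (Fin n → ℝ)} [IsFiniteMeasure P] [IsFiniteMeasure Q]
    (hP : ∀ᵐ u ∂P, 0 ≤ u) (hQ : ∀ᵐ u ∂Q, 0 ≤ u)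
    (h : ∀ m : Fin n → ℕ, laplace P (fun i => -(m i : ℝ)) = laplace Q (fun i => -(m i : ℝ))) :
    P = Q := by
  -- The Laplace transform at `-m` is the `m`-th moment of the image measure on the cube.
  have hmom : ∀ (ρ : Measure (Fin n → ℝ)), (∀ᵐ u ∂ρ, 0 ≤ u) → ∀ m : Fin n → ℕ,
      ∫ x, ∏ i, (x i : ℝ) ^ m i ∂ρ.map expNeg = laplace ρ (fun i => -(m i : ℝ)) := by
    intro ρ hR m
    rw [integral_map measurable_expNeg.aemeasurable]
    · exact integral_congr_ae (hR.mono fun u hu => prod_expNeg_pow hu m)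
    · have : Continuous fun x : Fin n → unitInterval => ∏ i, (x i : ℝ) ^ m i := by fun_prop
      exact this.aestronglyMeasurable
  have hback : ∀ (ρ : Measure (Fin n → ℝ)), (∀ᵐ u ∂ρ, 0 ≤ u) →
      (ρ.map expNeg).map negLog = ρ := fun ρ hR => by
    rw [Measure.map_map measurable_negLog measurable_expNeg]
    conv_rhs => rw [← Measure.map_id (μ := ρ)]
    exact Measure.map_congr (hR.mono fun u hu => negLog_expNeg hu)
  rw [← hback P hP, ← hback Q hQ]
  congr 1
  refine ext_of_moments fun m => ?_
  rw [hmom P hP, hmom Q hQ, h]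

/-- Uniqueness of the Laplace transform. -/
theorem LaplaceFinite.ext {P Q : Measure (Fin n → ℝ)} (hP : LaplaceFinite P)
    (hQ : LaplaceFinite Q) (h : ∀ s ∈ negOrthant n, laplace P s = laplace Q s) : P = Q := by
  -- Tilting by `e` makes both measures finite, and the points `e - m` stay in the open orthant even
  -- for `m = 0`.
  set e : Fin n → ℝ := fun _ => -1 with he
  have hem : ∀ m : Fin n → ℕ, e + (fun i => -(m i : ℝ)) ∈ negOrthant n := fun m i => by
    have : (0 : ℝ) ≤ m i := Nat.cast_nonneg _
    simp only [he, Pi.add_apply]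
    linarith
  have he0 : e ∈ negOrthant n := fun i => by simp [he]
  have := isFiniteMeasure_expTilt (hP.integrable e he0)
  have := isFiniteMeasure_expTilt (hQ.integrable e he0)
  have key : expTilt P e = expTilt Q e :=
    ext_of_laplace_neg_nat (expTilt_ae_nonneg hP.nonneg e) (expTilt_ae_nonneg hQ.nonneg e)
      fun m => by
        rw [laplace, laplace, integral_exp_expTilt, integral_exp_expTilt]
        exact h _ (hem m)
  have := congrArg (fun ρ => expTilt ρ (-e)) key
  simpa only [expTilt_expTilt, add_neg_cancel, expTilt_zero] using this

/-! ### Positive differences and discrete approximation of the representing measure -/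

/-- The action of `ℝ^n` by translations on the functions on `ℝ^n`. -/
noncomputable def translationHom (n : ℕ) :
    Multiplicative (Fin n → ℝ) →* Module.End ℝ ((Fin n → ℝ) → ℝ) where
  toFun t :=
    { toFun := fun f s => f (s - t.toAdd)
      map_add' := fun _ _ => rfl
      map_smul' := fun _ _ => rfl }
  map_one' := by
    ext f s
    simp
  map_mul' t t' := by
    ext f s
    simp [sub_sub]

/-- The action of the group algebra of `ℝ^n` on the functions on `ℝ^n` by linear combinations of
translations. -/
noncomputable def translation (n : ℕ) :
    AddMonoidAlgebra ℝ (Fin n → ℝ) →ₐ[ℝ] Module.End ℝ ((Fin n → ℝ) → ℝ) :=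
  AddMonoidAlgebra.lift ℝ _ _ (translationHom n)

/-- The element of the group algebra that acts as `f ↦ f(· - t)`. -/
noncomputable def shift (t : Fin n → ℝ) : AddMonoidAlgebra ℝ (Fin n → ℝ) :=
  AddMonoidAlgebra.of ℝ (Fin n → ℝ) (Multiplicative.ofAdd t)

lemma translation_shift (t : Fin n → ℝ) (f : (Fin n → ℝ) → ℝ) :
    translation n (shift t) f = fun s => f (s - t) := by
  rw [translation, shift, AddMonoidAlgebra.lift_of]
  rfl

lemma prod_shift_single_pow (h : ℝ) (j : Fin n → ℕ) :
    ∏ i, shift (Pi.single i h) ^ j i = shift (fun i => h * j i) := by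
  simp only [shift, ← map_pow, ← map_prod]
  congr 1
  simp only [← ofAdd_nsmul, ← ofAdd_sum]
  congr 1
  funext i
  simp [Finset.sum_apply, Pi.single_apply, mul_comm]

/-- The linear combinations of translations that preserve absolute monotonicity. -/
def preserving (n : ℕ) : Submonoid (AddMonoidAlgebra ℝ (Fin n → ℝ)) where
  carrier := {p | ∀ f, AbsolutelyMonotone f → AbsolutelyMonotone (translation n p f)}
  one_mem' f hf := by simpa using hf
  mul_mem' {p q} hp hq f hf := by
    rw [map_mul]
    exact hp _ (hq _ hf)

lemma shift_mem_preserving {t : Fin n → ℝ} (ht : 0 ≤ t) : shift t ∈ preserving n := fun f hf => by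
  rw [translation_shift]
  exact hf.comp_sub ht

lemma one_sub_shift_mem_preserving {t : Fin n → ℝ} (ht : 0 ≤ t) :
    1 - shift t ∈ preserving n := fun f hf => by
  rw [map_sub, LinearMap.sub_apply, translation_shift, map_one]
  exact hf.sub_comp_sub ht

/-- Choosing a subset of a subset, counted in both orders and multiplied by `j!`. -/
lemma choose_mul_descFactorial_add (r j l : ℕ) :
    (j + r).choose (j + l) * (j + l).descFactorial j = (j + r).descFactorial j * r.choose l := by
  have h := Nat.choose_mul (n := j + r) (Nat.le_add_right j l)
  rw [Nat.add_sub_cancel_left, Nat.add_sub_cancel_left] at h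
  rw [Nat.descFactorial_eq_factorial_mul_choose, Nat.descFactorial_eq_factorial_mul_choose,
    mul_left_comm, h, mul_assoc]

/-- The factorial moments of the binomial distribution, as a polynomial identity. -/
lemma sum_choose_descFactorial_smul {R : Type*} [CommRing R] [Algebra ℝ R] (x : R) {j M : ℕ}
    (hj : j ≤ M) :
    ∑ k ∈ Finset.range (M + 1),
      ((M.choose k : ℝ) * (k.descFactorial j / M.descFactorial j)) • (x ^ k * (1 - x) ^ (M - k))
      = x ^ j := by
  obtain ⟨r, rfl⟩ := Nat.exists_eq_add_of_le hj
  -- The terms with `k < j` vanish with the falling factorial; the others sum to `x^j (x + (1 -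
  -- x))^r`.
  rw [add_assoc, Finset.sum_range_add]
  have h0 : ∀ k ∈ Finset.range j, (((j + r).choose k : ℝ) *
      (k.descFactorial j / (j + r).descFactorial j)) • (x ^ k * (1 - x) ^ (j + r - k)) = 0 :=
    fun k hk => by
      rw [Nat.descFactorial_eq_zero_iff_lt.2 (Finset.mem_range.1 hk)]
      simp
  have h1 : ∀ l ∈ Finset.range (r + 1), (((j + r).choose (j + l) : ℝ) *
      ((j + l).descFactorial j / (j + r).descFactorial j)) •
        (x ^ (j + l) * (1 - x) ^ (j + r - (j + l))) =
      x ^ j * (x ^ l * (1 - x) ^ (r - l) * (r.choose l : R)) := fun l _ => by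
    have hne : ((j + r).descFactorial j : ℝ) ≠ 0 := by
      rw [Nat.cast_ne_zero, Ne, Nat.descFactorial_eq_zero_iff_lt]
      omega
    have hc : ((j + r).choose (j + l) : ℝ) *
        ((j + l).descFactorial j / (j + r).descFactorial j) = r.choose l := by
      rw [← mul_div_assoc, div_eq_iff hne, mul_comm (r.choose l : ℝ)]
      exact_mod_cast choose_mul_descFactorial_add r j l
    rw [hc, Nat.add_sub_add_left, Nat.cast_smul_eq_nsmul, nsmul_eq_mul, pow_add]
    ring
  rw [Finset.sum_eq_zero h0, Finset.sum_congr rfl h1, ← Finset.mul_sum, ← add_pow]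
  simp

/-- Replacing one factor at a time changes the product by at most the change of that factor, because
the other factors lie in `[0, 1]`. -/
lemma abs_prod_sub_prod_le {ι : Type*} (s : Finset ι) (a b : ι → ℝ)
    (ha : ∀ i ∈ s, 0 ≤ a i ∧ a i ≤ 1) (hb : ∀ i ∈ s, 0 ≤ b i ∧ b i ≤ 1) :
    |∏ i ∈ s, a i - ∏ i ∈ s, b i| ≤ ∑ i ∈ s, |a i - b i| := by
  classical
  induction s using Finset.induction_on with
  | empty => simp
  | insert i s hi ih =>
    rw [Finset.prod_insert hi, Finset.prod_insert hi, Finset.sum_insert hi]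
    have ha' := fun k hk => ha k (Finset.mem_insert_of_mem hk)
    have hb' := fun k hk => hb k (Finset.mem_insert_of_mem hk)
    have h1 : |∏ k ∈ s, b k| ≤ 1 := by
      rw [abs_of_nonneg (Finset.prod_nonneg fun k hk => (hb' k hk).1)]
      exact Finset.prod_le_one (fun k hk => (hb' k hk).1) fun k hk => (hb' k hk).2
    have h2 : |a i| ≤ 1 := by
      rw [abs_of_nonneg (ha i (Finset.mem_insert_self _ _)).1]
      exact (ha i (Finset.mem_insert_self _ _)).2
    calc |a i * ∏ k ∈ s, a k - b i * ∏ k ∈ s, b k|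
        = |(a i - b i) * ∏ k ∈ s, b k + a i * (∏ k ∈ s, a k - ∏ k ∈ s, b k)| := by ring_nf
      _ ≤ |a i - b i| * 1 + 1 * ∑ k ∈ s, |a k - b k| := by
        refine (abs_add_le _ _).trans ?_
        rw [abs_mul, abs_mul]
        gcongr
        exact ih ha' hb'
      _ = _ := by ring

lemma descFactorial_div_mem {k M : ℕ} (hk : k ≤ M) (j : ℕ) :
    0 ≤ (k.descFactorial j / M.descFactorial j : ℝ) ∧
      (k.descFactorial j / M.descFactorial j : ℝ) ≤ 1 :=
  ⟨by positivity, div_le_one_of_le₀ (by exact_mod_cast Nat.descFactorial_le j hk) (by positivity)⟩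

lemma div_mem_unitInterval {k M : ℕ} (hk : k ≤ M) : (k / M : ℝ) ∈ unitInterval :=
  ⟨by positivity, div_le_one_of_le₀ (by exact_mod_cast hk) (by positivity)⟩

/-- The quotient is a product of `j` factors `(k - l)/(M - l)` with `l < j`, each within `l/M ≤ j/M`
of `k/M`. -/
lemma abs_descFactorial_div_sub_le {k M j : ℕ} (hk : k ≤ M) (hj : j ≤ M) :
    |(k.descFactorial j / M.descFactorial j : ℝ) - (k / M : ℝ) ^ j| ≤ (j : ℝ) ^ 2 / M := by
  have hprod : (k.descFactorial j / M.descFactorial j : ℝ) =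
      ∏ l ∈ Finset.range j, (((k - l : ℕ) : ℝ) / ((M - l : ℕ) : ℝ)) := by
    rw [Finset.prod_div_distrib, Nat.descFactorial_eq_prod_range, Nat.descFactorial_eq_prod_range]
    push_cast
    rfl
  have hpow : (k / M : ℝ) ^ j = ∏ _l ∈ Finset.range j, (k / M : ℝ) := by
    rw [Finset.prod_const, Finset.card_range]
  rw [hprod, hpow]
  refine (abs_prod_sub_prod_le _ _ _
    (fun l _ => div_mem_unitInterval (Nat.sub_le_sub_right hk l))
    fun l _ => div_mem_unitInterval hk).trans ?_
  have hl : ∀ l ∈ Finset.range j,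
      |((k - l : ℕ) : ℝ) / ((M - l : ℕ) : ℝ) - (k / M : ℝ)| ≤ (j / M : ℝ) := fun l hl => by
    have hlj := Finset.mem_range.1 hl
    have hM : (0 : ℝ) < M := by exact_mod_cast (by omega : 0 < M)
    have hlj' : (l : ℝ) ≤ j := by exact_mod_cast hlj.le
    have hkM : (k : ℝ) ≤ M := by exact_mod_cast hk
    have hle : (j / M : ℝ) ≥ l / M := by gcongr
    rcases le_total l k with h | h
    · have hMl : (0 : ℝ) < (M : ℝ) - l := by
        have : (l : ℝ) < M := by exact_mod_cast (by omega : l < M)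
        linarith
      rw [Nat.cast_sub h, Nat.cast_sub (by omega), abs_sub_comm]
      have hlk : (l : ℝ) ≤ k := by exact_mod_cast h
      have : (k / M : ℝ) - (k - l) / (M - l) = l / M * ((M - k) / (M - l)) := by
        field_simp
        ring
      rw [this, abs_of_nonneg (mul_nonneg (by positivity)
        (div_nonneg (by linarith) hMl.le))]
      refine le_trans (mul_le_of_le_one_right (by positivity) ?_) hle
      exact div_le_one_of_le₀ (by linarith) hMl.le
    -- Here the truncated difference `k - l` is zero, and `k/M ≤ l/M` is itself small enough.
    · rw [Nat.sub_eq_zero_of_le h]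
      simp only [Nat.cast_zero, zero_div, zero_sub, abs_neg]
      rw [abs_of_nonneg (by positivity)]
      have : (k : ℝ) ≤ l := by exact_mod_cast h
      exact le_trans (by gcongr) hle
  refine (Finset.sum_le_sum hl).trans (le_of_eq ?_)
  simp
  ring

lemma exists_measure_sum_dirac {X ι : Type*} [MeasurableSpace X] [MeasurableSingletonClass X]
    (S : Finset ι) (w : ι → ℝ) (hw : ∀ k ∈ S, 0 ≤ w k) (x : ι → X) :
    ∃ μ : Measure X, IsFiniteMeasure μ ∧ ∀ g : X → ℝ, ∫ y, g y ∂μ = ∑ k ∈ S, w k * g (x k) := by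
  refine ⟨∑ k ∈ S, ENNReal.ofReal (w k) • Measure.dirac (x k), ?_, fun g => ?_⟩
  · refine ⟨?_⟩
    simp only [Measure.coe_finsetSum, Finset.sum_apply, Measure.smul_apply]
    exact ENNReal.sum_lt_top.2 fun k _ => by simp
  · rw [integral_finsetSum_measure]
    · refine Finset.sum_congr rfl fun k hk => ?_
      rw [integral_smul_measure, integral_dirac, ENNReal.toReal_ofReal (hw k hk), smul_eq_mul]
    · exact fun k _ => (integrable_dirac (by simp)).smul_measure (by simp)

/-- The discrete approximations of the representing measure of an absolutely monotone function. -/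
lemma AbsolutelyMonotone.exists_approx_measure {f : (Fin n → ℝ) → ℝ} (hf : AbsolutelyMonotone f)
    {a : Fin n → ℝ} (ha : a ∈ negOrthant n) {h : ℝ} (hh : 0 ≤ h) (M : ℕ) :
    ∃ μ : Measure (Fin n → unitInterval), IsFiniteMeasure μ ∧ μ.real univ = f a ∧
      ∀ j : Fin n → ℕ, (∀ i, j i ≤ M) →
        |∫ y, ∏ i, (y i : ℝ) ^ j i ∂μ - f (a - fun i => h * j i)|
          ≤ f a * ∑ i, (j i : ℝ) ^ 2 / M := by
  classical
  set S : Finset (Fin n → ℕ) := Fintype.piFinset fun _ => Finset.range (M + 1) with hS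
  have hmem : ∀ k ∈ S, ∀ i, k i ≤ M := fun k hk i => by
    have := Fintype.mem_piFinset.1 hk i
    exact Nat.lt_succ_iff.1 (Finset.mem_range.1 this)
  set T : Fin n → AddMonoidAlgebra ℝ (Fin n → ℝ) := fun i => shift (Pi.single i h) with hT
  have hT0 : ∀ i, (0 : Fin n → ℝ) ≤ Pi.single i h := fun i => Pi.single_nonneg.2 hh
  -- The binomial weights: terms of `∏ (T_i + (1 - T_i))^M` applied to `f` at `a`, nonnegative
  -- because `T_i` and `1 - T_i` preserve absolute monotonicity.
  set w : (Fin n → ℕ) → ℝ := fun k => (∏ i, (M.choose (k i) : ℝ)) *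
    translation n (∏ i, (T i ^ k i * (1 - T i) ^ (M - k i))) f a with hw
  have hw0 : ∀ k, 0 ≤ w k := fun k => by
    refine mul_nonneg (by positivity) (AbsolutelyMonotone.nonneg ?_ ha)
    refine (preserving n).prod_mem (fun i _ => ?_) f hf
    exact mul_mem (pow_mem (shift_mem_preserving (hT0 i)) _)
      (pow_mem (one_sub_shift_mem_preserving (hT0 i)) _)
  -- The factorial moments of the weights are exact values of `f`; passing to ordinary moments costs
  -- the error `j_i² / M` in each coordinate.
  have hmom : ∀ j : Fin n → ℕ, (∀ i, j i ≤ M) →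
      ∑ k ∈ S, w k * ∏ i, ((k i).descFactorial (j i) / M.descFactorial (j i) : ℝ) =
        f (a - fun i => h * j i) := fun j hj => by
    have h1 : ∏ i, ∑ k ∈ Finset.range (M + 1),
        ((M.choose k : ℝ) * (k.descFactorial (j i) / M.descFactorial (j i))) •
          (T i ^ k * (1 - T i) ^ (M - k)) = shift (fun i => h * j i) := by
      rw [← prod_shift_single_pow]
      exact Finset.prod_congr rfl fun i _ => sum_choose_descFactorial_smul (T i) (hj i)
    rw [Finset.prod_univ_sum] at h1
    have h2 := congrArg (fun p => translation n p f a) h1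
    simp only [translation_shift, map_sum, LinearMap.sum_apply, Finset.sum_apply,
      Finset.prod_smul, map_smul, LinearMap.smul_apply, Pi.smul_apply, smul_eq_mul] at h2
    rw [← h2]
    refine Finset.sum_congr rfl fun k _ => ?_
    rw [hw, Finset.prod_mul_distrib]
    ring
  have hsum : ∑ k ∈ S, w k = f a := by
    have := hmom 0 (fun _ => Nat.zero_le _)
    simpa [show (fun _ : Fin n => (0 : ℝ)) = 0 from rfl] using this
  -- The atoms `k/M`; the default `0` is never met for `k ∈ S`.
  let x : (Fin n → ℕ) → Fin n → unitInterval := fun k i =>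
    if hk : k i ≤ M then ⟨_, div_mem_unitInterval hk⟩ else 0
  have hx : ∀ k ∈ S, ∀ i, (x k i : ℝ) = k i / M := fun k hk i => by simp [x, hmem k hk i]
  obtain ⟨μ, hμ, hint⟩ := exists_measure_sum_dirac S w (fun k _ => hw0 k) x
  refine ⟨μ, hμ, ?_, fun j hj => ?_⟩
  · have := hint fun _ => 1
    simpa [hsum] using this
  · rw [hint, ← hmom j hj, ← Finset.sum_sub_distrib, ← hsum, Finset.sum_mul]
    refine (Finset.abs_sum_le_sum_abs _ _).trans (Finset.sum_le_sum fun k hk => ?_)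
    rw [← mul_sub, abs_mul, abs_of_nonneg (hw0 k), abs_sub_comm]
    refine mul_le_mul_of_nonneg_left ?_ (hw0 k)
    refine (abs_prod_sub_prod_le _ _ _
      (fun i _ => descFactorial_div_mem (hmem k hk i) _)
      fun i _ => ⟨pow_nonneg (x k i).2.1 _, pow_le_one₀ (x k i).2.1 (x k i).2.2⟩).trans ?_
    refine Finset.sum_le_sum fun i _ => ?_
    rw [hx k hk i]
    exact abs_descFactorial_div_sub_le (hmem k hk i) (hj i)

/-! ### Bernstein's theorem: limit measure and passage to the Laplace transform -/

lemma continuous_prod_rpow {t : Fin n → ℝ} (ht : 0 ≤ t) :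
    Continuous fun x : Fin n → unitInterval => ∏ i, (x i : ℝ) ^ t i :=
  continuous_finsetProd _ fun i _ => (continuous_coe_apply i).rpow_const fun _ => Or.inr (ht i)

lemma prod_rpow_mem {t : Fin n → ℝ} (ht : 0 ≤ t) (x : Fin n → unitInterval) :
    0 ≤ ∏ i, (x i : ℝ) ^ t i ∧ ∏ i, (x i : ℝ) ^ t i ≤ 1 :=
  ⟨Finset.prod_nonneg fun i _ => Real.rpow_nonneg (x i).2.1 _,
    Finset.prod_le_one (fun i _ => Real.rpow_nonneg (x i).2.1 _)
      fun i _ => Real.rpow_le_one (x i).2.1 (x i).2.2 (ht i)⟩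

lemma dyadic_nonneg (j : Fin n → ℕ) (q : ℕ) : (0 : Fin n → ℝ) ≤ fun i => (j i : ℝ) / 2 ^ q :=
  fun i => by
    show (0 : ℝ) ≤ (j i : ℝ) / 2 ^ q
    positivity

/-- The values of an absolutely monotone function on a translated dyadic grid are the fractional
moments of a measure on the unit cube. -/
lemma AbsolutelyMonotone.exists_measure_cube {f : (Fin n → ℝ) → ℝ} (hf : AbsolutelyMonotone f)
    {a : Fin n → ℝ} (ha : a ∈ negOrthant n) :
    ∃ μ : Measure (Fin n → unitInterval), IsFiniteMeasure μ ∧ ∀ (q : ℕ) (j : Fin n → ℕ),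
      ∫ x, ∏ i, (x i : ℝ) ^ ((j i : ℝ) / 2 ^ q) ∂μ = f (a - fun i => (j i : ℝ) / 2 ^ q) := by
  -- Mesh `2^{-p}` and degree `8^p`: the moment of order `j/2^q` becomes one of order `j 2^{p-q}`,
  -- whose square is of order `4^p`, so the error is `O(2^{-p})`.
  have hex := fun p : ℕ => hf.exists_approx_measure ha (h := (2 ^ p)⁻¹) (by positivity) (8 ^ p)
  choose μ₀ hfin hmass hmom using hex
  -- The atoms stand for `e^{-hu}` with `h = 2^{-p}`; the power `2^p` rescales them to `e^{-u}`, so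
  -- that the measures for different `p` are comparable.
  let φ : ℕ → (Fin n → unitInterval) → Fin n → unitInterval := fun p y i => y i ^ 2 ^ p
  have hφ : ∀ p, Continuous (φ p) := fun p => by fun_prop
  let ρ : ℕ → FiniteMeasure (Fin n → unitInterval) := fun p => ⟨(μ₀ p).map (φ p), inferInstance⟩
  have hρ : ∀ p, ρ p ∈ {μ : FiniteMeasure (Fin n → unitInterval) | μ.mass ≤ (f a).toNNReal} :=
    fun p => by
      have h1 : ((ρ p).mass : ℝ) = f a := by
        rw [← hmass p]
        change ((μ₀ p).map (φ p)).real univ = _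
        rw [map_measureReal_apply (hφ p).measurable MeasurableSet.univ, preimage_univ]
      have h2 : (ρ p).mass = (f a).toNNReal := by rw [← h1, Real.toNNReal_coe]
      exact h2.le
  -- Measures of bounded mass on the compact cube form a weakly compact set; an ultrafilter limit
  -- avoids extracting a subsequence.
  obtain ⟨μ, -, hμ⟩ := (isCompact_setOfPred_finiteMeasure_le_of_compactSpace
    (Fin n → unitInterval) (f a).toNNReal).ultrafilter_le_nhds ((hyperfilter ℕ).map ρ)
    (tendsto_principal.2 (Eventually.of_forall hρ))
  refine ⟨μ, inferInstance, fun q j => ?_⟩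
  have hcont := continuous_prod_rpow (dyadic_nonneg j q)
  have hlim := FiniteMeasure.tendsto_iff_forall_integral_tendsto.1
    (show Tendsto ρ (hyperfilter ℕ) (𝓝 μ) from hμ)
    (BoundedContinuousFunction.mkOfCompact ⟨_, hcont⟩)
  simp only [BoundedContinuousFunction.mkOfCompact_apply, ContinuousMap.coe_mk] at hlim
  refine tendsto_nhds_unique hlim (Tendsto.mono_left ?_ Nat.hyperfilter_le_atTop)
  rw [tendsto_iff_norm_sub_tendsto_zero]
  have hz : Tendsto (fun p : ℕ => f a * ∑ i, (j i : ℝ) ^ 2 * (1 / 2) ^ p) atTop (𝓝 0) := by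
    have h0 : Tendsto (fun p : ℕ => (1 / 2 : ℝ) ^ p) atTop (𝓝 0) :=
      tendsto_pow_atTop_nhds_zero_of_lt_one (by norm_num) (by norm_num)
    have := (tendsto_finsetSum Finset.univ
      fun i _ => h0.const_mul ((j i : ℝ) ^ 2)).const_mul (f a)
    simpa using this
  refine squeeze_zero' (Eventually.of_forall fun _ => norm_nonneg _) ?_ hz
  filter_upwards [eventually_ge_atTop (q + ∑ i, j i)] with p hp
  obtain ⟨r, rfl⟩ : ∃ r, p = q + r := Nat.exists_eq_add_of_le (by omega)
  have hjr : ∀ i, j i ≤ 2 ^ r := fun i => by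
    have h1 : j i ≤ ∑ i, j i := Finset.single_le_sum (fun _ _ => Nat.zero_le _) (Finset.mem_univ i)
    have h2 : r < 2 ^ r := Nat.lt_two_pow_self
    omega
  have hle : ∀ i, j i * 2 ^ r ≤ 8 ^ (q + r) := fun i => by
    calc j i * 2 ^ r ≤ 2 ^ r * 2 ^ r := Nat.mul_le_mul_right _ (hjr i)
      _ = 4 ^ r := by rw [← mul_pow]; norm_num
      _ ≤ 8 ^ r := Nat.pow_le_pow_left (by norm_num) r
      _ ≤ 8 ^ (q + r) := Nat.pow_le_pow_right (by norm_num) (by omega)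
  have hint : ∫ x, ∏ i, (x i : ℝ) ^ ((j i : ℝ) / 2 ^ q) ∂(ρ (q + r) : Measure (Fin n → unitInterval)) =
      ∫ y, ∏ i, (y i : ℝ) ^ (j i * 2 ^ r) ∂μ₀ (q + r) := by
    change ∫ x, _ ∂(μ₀ (q + r)).map (φ (q + r)) = _
    rw [integral_map (hφ _).measurable.aemeasurable hcont.aestronglyMeasurable]
    refine integral_congr_ae (Eventually.of_forall fun y => ?_)
    refine Finset.prod_congr rfl fun i _ => ?_
    have hy : (0 : ℝ) ≤ y i := (y i).2.1
    change ((y i : ℝ) ^ 2 ^ (q + r)) ^ ((j i : ℝ) / 2 ^ q) = _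
    rw [← Real.rpow_natCast (y i : ℝ) (2 ^ (q + r)), ← Real.rpow_mul hy,
      ← Real.rpow_natCast (y i : ℝ) (j i * 2 ^ r)]
    congr 1
    push_cast
    rw [pow_add]
    field_simp
  have hpt : (fun i => (2 ^ (q + r) : ℝ)⁻¹ * ((j i * 2 ^ r : ℕ) : ℝ)) =
      fun i => (j i : ℝ) / 2 ^ q := by
    funext i
    push_cast
    rw [pow_add]
    field_simp
  have hb := hmom (q + r) (fun i => j i * 2 ^ r) hle
  rw [hpt] at hb
  rw [hint, Real.norm_eq_abs]
  refine hb.trans (mul_le_mul_of_nonneg_left (Finset.sum_le_sum fun i _ => ?_) (hf.nonneg ha))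
  have h8 : (8 : ℝ) ^ (q + r) = 2 ^ (q + r) * (2 ^ (q + r)) ^ 2 := by
    rw [← pow_mul, mul_comm (q + r) 2, pow_mul, ← mul_pow]
    norm_num
  have h4 : ((2 : ℝ) ^ r) ^ 2 ≤ (2 ^ (q + r)) ^ 2 := by
    gcongr
    · norm_num
    · omega
  push_cast
  rw [h8, mul_pow, one_div, inv_pow, mul_div_assoc]
  refine mul_le_mul_of_nonneg_left ?_ (by positivity)
  rw [div_le_iff₀ (by positivity), ← mul_assoc, inv_mul_cancel₀ (by positivity), one_mul]
  exact h4

/-- Dominated convergence for fractional moments along a sequence. -/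
lemma tendsto_integral_prod_rpow {μ : Measure (Fin n → unitInterval)} [IsFiniteMeasure μ]
    {t : ℕ → Fin n → ℝ} (ht : ∀ q, 0 ≤ t q) {g : (Fin n → unitInterval) → ℝ}
    (hg : ∀ᵐ x ∂μ, Tendsto (fun q => ∏ i, (x i : ℝ) ^ t q i) atTop (𝓝 (g x))) :
    Tendsto (fun q => ∫ x, ∏ i, (x i : ℝ) ^ t q i ∂μ) atTop (𝓝 (∫ x, g x ∂μ)) :=
  tendsto_integral_of_dominated_convergence (fun _ => 1)
    (fun q => (continuous_prod_rpow (ht q)).aestronglyMeasurable) (integrable_const _)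
    (fun q => Eventually.of_forall fun x => by
      rw [Real.norm_of_nonneg (prod_rpow_mem (ht q) x).1]
      exact (prod_rpow_mem (ht q) x).2) hg

lemma tendsto_comp_sub {f : (Fin n → ℝ) → ℝ} (hf : ContDiffOn ℝ ∞ f (negOrthant n))
    {a : Fin n → ℝ} (ha : a ∈ negOrthant n) {t : ℕ → Fin n → ℝ} {t₀ : Fin n → ℝ} (ht₀ : 0 ≤ t₀)
    (ht : Tendsto t atTop (𝓝 t₀)) :
    Tendsto (fun q => f (a - t q)) atTop (𝓝 (f (a - t₀))) :=
  (differentiableAt_of_contDiffOn hf (sub_mem_negOrthant ha ht₀)).continuousAt.tendsto.comp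
    (tendsto_const_nhds.sub ht)

lemma tendsto_two_pow_atTop : Tendsto (fun q : ℕ => (2 : ℝ) ^ q) atTop atTop :=
  tendsto_pow_atTop_atTop_of_one_lt (by norm_num)

lemma AbsolutelyMonotone.exists_laplace_translate {f : (Fin n → ℝ) → ℝ}
    (hf : AbsolutelyMonotone f) {a : Fin n → ℝ} (ha : a ∈ negOrthant n) :
    ∃ ν : Measure (Fin n → ℝ), IsFiniteMeasure ν ∧ (∀ᵐ u ∂ν, 0 ≤ u) ∧
      ∀ t, 0 ≤ t → laplace ν (-t) = f (a - t) := by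
  obtain ⟨μ, hfin, hμ⟩ := hf.exists_measure_cube ha
  -- No mass lies on the faces `x_i = 0`: the moments of order `2^{-q}` tend to the mass of the
  -- positive part, and by continuity of `f` at `a` also to `f a`, the total mass.
  have hpos : ∀ᵐ x ∂μ, ∀ i, (0 : ℝ) < x i := by
    classical
    set g : (Fin n → unitInterval) → ℝ := fun x => if ∀ i, (0 : ℝ) < x i then 1 else 0 with hg
    have h1 : Tendsto (fun q : ℕ => ∫ x, ∏ i : Fin n, (x i : ℝ) ^ (((1 : ℕ) : ℝ) / 2 ^ q) ∂μ)
        atTop (𝓝 (∫ x, g x ∂μ)) := by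
      refine tendsto_integral_prod_rpow (fun q => dyadic_nonneg (fun _ => 1) q)
        (Eventually.of_forall fun x => ?_)
      have h0 : Tendsto (fun q : ℕ => ((1 : ℕ) : ℝ) / 2 ^ q) atTop (𝓝 0) :=
        tendsto_const_nhds.div_atTop tendsto_two_pow_atTop
      by_cases hx : ∀ i, (0 : ℝ) < x i
      · have := tendsto_finsetProd (Finset.univ : Finset (Fin n)) fun i _ =>
          (tendsto_const_nhds (x := (x i : ℝ))).rpow h0 (Or.inl (hx i).ne')
        rw [show g x = 1 by simp only [hg, if_pos hx]]
        simpa using this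
      · obtain ⟨i, hi⟩ := not_forall.1 hx
        have hi0 : (x i : ℝ) = 0 := le_antisymm (not_lt.1 hi) (x i).2.1
        rw [show g x = 0 by simp only [hg, if_neg hx]]
        refine tendsto_const_nhds.congr fun q => ?_
        refine (Finset.prod_eq_zero (Finset.mem_univ i) ?_).symm
        rw [hi0, Real.zero_rpow (by positivity)]
    have h2 : Tendsto (fun q : ℕ => ∫ x, ∏ i : Fin n, (x i : ℝ) ^ (((1 : ℕ) : ℝ) / 2 ^ q) ∂μ)
        atTop (𝓝 (f (a - 0))) := by
      simp only [fun q => hμ q fun _ => 1]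
      refine tendsto_comp_sub hf.1 ha le_rfl (tendsto_pi_nhds.2 fun i => ?_)
      exact tendsto_const_nhds.div_atTop tendsto_two_pow_atTop
    have h3 : ∫ _x, (1 : ℝ) ∂μ = f (a - 0) := by
      simpa [show (fun _ : Fin n => (0 : ℝ)) = 0 from rfl] using hμ 0 0
    have hgm : Measurable g := by
      refine Measurable.ite ?_ measurable_const measurable_const
      simp only [ofPred_forall]
      exact MeasurableSet.iInter fun i =>
        measurableSet_lt measurable_const (continuous_coe_apply i).measurable
    have hgi : Integrable g μ := Integrable.mono' (integrable_const 1) hgm.aestronglyMeasurable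
      (Eventually.of_forall fun x => by simp only [hg]; split_ifs <;> simp)
    have h4 : ∫ x, (1 - g x) ∂μ = 0 := by
      rw [integral_sub (integrable_const _) hgi, h3, tendsto_nhds_unique h1 h2, sub_self]
    have hnn : 0 ≤ fun x => 1 - g x := fun x => by
      simp only [hg, Pi.zero_apply]
      split_ifs <;> simp
    have h5 := (integral_eq_zero_iff_of_nonneg hnn ((integrable_const _).sub hgi)).1 h4
    filter_upwards [h5] with x hx
    by_contra hx'
    simp only [show g x = 0 from if_neg hx', sub_zero, Pi.zero_apply, one_ne_zero] at hx
  -- Positivity is essential here: at `x_i = 0` the convention `log 0 = 0` would give `1` instead of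
  -- `0 ^ t_i`.
  have hpow : ∀ t : Fin n → ℝ, ∀ᵐ x ∂μ,
      Real.exp ((-t) ⬝ᵥ negLog x) = ∏ i, (x i : ℝ) ^ t i := fun t => by
    filter_upwards [hpos] with x hx
    rw [dotProduct, Real.exp_sum]
    refine Finset.prod_congr rfl fun i _ => ?_
    rw [Real.rpow_def_of_pos (hx i), negLog, Pi.neg_apply, neg_mul_neg, mul_comm]
  have hlap : ∀ t : Fin n → ℝ, laplace (μ.map negLog) (-t) = ∫ x, ∏ i, (x i : ℝ) ^ t i ∂μ :=
    fun t => by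
      rw [laplace, integral_map measurable_negLog.aemeasurable
        (by fun_prop : Measurable _).aestronglyMeasurable]
      exact integral_congr_ae (hpow t)
  refine ⟨μ.map negLog, inferInstance, ?_, fun t ht => ?_⟩
  · exact (ae_map_iff measurable_negLog.aemeasurable measurableSet_Ici).2
      (Eventually.of_forall negLog_nonneg)
  · rw [hlap]
    -- Dyadic approximation of `t` from below; both sides are continuous along it.
    set j : ℕ → Fin n → ℕ := fun q i => ⌊t i * 2 ^ q⌋₊
    have hj : Tendsto (fun q i => (j q i : ℝ) / 2 ^ q) atTop (𝓝 t) :=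
      tendsto_pi_nhds.2 fun i =>
        (tendsto_nat_floor_mul_div_atTop (ht i)).comp tendsto_two_pow_atTop
    have h1 := tendsto_integral_prod_rpow (μ := μ) (fun q => dyadic_nonneg (j q) q)
      (g := fun x => ∏ i, (x i : ℝ) ^ t i) (by
        filter_upwards [hpos] with x hx
        exact tendsto_finsetProd _ fun i _ => tendsto_const_nhds.rpow
          (tendsto_pi_nhds.1 hj i) (Or.inl (hx i).ne'))
    simp only [fun q => hμ q (j q)] at h1
    exact tendsto_nhds_unique h1 (tendsto_comp_sub hf.1 ha ht hj)

/-- **Bernstein's theorem** in several variables: absolutely monotone functions on the negative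
orthant are Laplace transforms. -/
theorem AbsolutelyMonotone.exists_laplace {f : (Fin n → ℝ) → ℝ} (hf : AbsolutelyMonotone f) :
    ∃ ν : Measure (Fin n → ℝ), LaplaceFinite ν ∧ EqOn f (laplace ν) (negOrthant n) := by
  set e : Fin n → ℝ := fun _ => -1 with he
  have he0 : e ∈ negOrthant n := fun i => by simp [he]
  obtain ⟨ν₀, hfin₀, hnn₀, hν₀⟩ := hf.exists_laplace_translate he0
  have key : ∀ s ∈ negOrthant n, Integrable (fun u => Real.exp (s ⬝ᵥ u)) (expTilt ν₀ (-e)) ∧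
      f s = laplace (expTilt ν₀ (-e)) s := fun s hs => by
    -- A base point above both `s` and `e`. Its measure, tilted to `e`, is `ν₀` by uniqueness, so
    -- one tilt of `ν₀` represents `f` at every `s`.
    set a : Fin n → ℝ := s ⊔ e with ha
    have ha0 : a ∈ negOrthant n := fun i => max_lt (hs i) (he0 i)
    obtain ⟨ν, hfin, hnn, hν⟩ := hf.exists_laplace_translate ha0
    have hint : ∀ t : Fin n → ℝ, t ≤ 0 → Integrable (fun u => Real.exp (t ⬝ᵥ u)) ν := fun t ht =>
      Integrable.mono' (integrable_const 1) (by fun_prop : Measurable _).aestronglyMeasurable (by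
        filter_upwards [hnn] with u hu
        rw [Real.norm_of_nonneg (Real.exp_pos _).le]
        exact Real.exp_le_one_iff.2 (dotProduct_nonpos_of_nonpos ht hu))
    have hea : e - a ≤ 0 := sub_nonpos.2 le_sup_right
    have := isFiniteMeasure_expTilt (hint _ hea)
    have heq : expTilt ν (e - a) = ν₀ := by
      refine ext_of_laplace_neg_nat (expTilt_ae_nonneg hnn _) hnn₀ fun m => ?_
      have hm : (0 : Fin n → ℝ) ≤ fun i => (m i : ℝ) := fun i => Nat.cast_nonneg _
      have h1 := hν₀ _ hm
      have h2 := hν (a - e + fun i => (m i : ℝ)) (add_nonneg (sub_nonneg.2 le_sup_right) hm)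
      rw [laplace, integral_exp_expTilt]
      rw [show (fun i => -(m i : ℝ)) = -fun i => (m i : ℝ) from rfl, h1,
        show e - a + -(fun i => (m i : ℝ)) = -(a - e + fun i => (m i : ℝ)) by abel]
      refine h2.trans ?_
      congr 1
      abel
    rw [← heq, expTilt_expTilt, show e - a + -e = -a by abel]
    refine ⟨integrable_exp_expTilt.2 (hint _ ?_), ?_⟩
    · rw [neg_add_eq_sub]
      exact sub_nonpos.2 le_sup_left
    · have h3 := hν (a - s) (sub_nonneg.2 le_sup_left)
      rw [sub_sub_cancel] at h3
      rw [laplace, integral_exp_expTilt, ← h3, laplace, show -(a - s) = -a + s by abel]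
  exact ⟨expTilt ν₀ (-e), ⟨expTilt_ae_nonneg hnn₀ _, fun s hs => (key s hs).1⟩,
    fun s hs => (key s hs).2⟩

/-! ### From the Lévy–Khintchine formula to the class `T_n` -/

lemma measurableSet_puncturedOrthant (n : ℕ) : MeasurableSet (puncturedOrthant n) := by
  have : puncturedOrthant n = Ici 0 \ {0} := by
    ext u
    exact Iff.rfl
  rw [this]
  exact measurableSet_Ici.diff (measurableSet_singleton 0)

/-- `y e^{-y} ≤ 1 - e^{-y}`, so that integrability of `e^{s · u} - 1` implies that of
`u_i e^{s · u}`. -/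
lemma integrable_coord_mul_of_integrable_exp_sub_one {μ : Measure (Fin n → ℝ)}
    (hμ : ∀ᵐ u ∂μ, 0 ≤ u) {s : Fin n → ℝ} (hs : s ∈ negOrthant n)
    (h : Integrable (fun u => Real.exp (s ⬝ᵥ u) - 1) μ) (i : Fin n) :
    Integrable (fun u => u i * Real.exp (s ⬝ᵥ u)) μ := by
  have hsi : 0 < -s i := neg_pos.2 (hs i)
  refine Integrable.mono' (h.norm.const_mul (-s i)⁻¹)
    (by fun_prop : Measurable _).aestronglyMeasurable ?_
  filter_upwards [hμ] with u hu
  have hy := dotProduct_nonpos_of_nonpos (negOrthant_nonpos hs) hu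
  rw [Real.norm_of_nonneg (mul_nonneg (hu i) (Real.exp_pos _).le), inv_mul_eq_div,
    le_div_iff₀ hsi, Real.norm_eq_abs, abs_of_nonpos (by simpa using hy)]
  have h1 := mul_single_le_neg_dotProduct (negOrthant_nonpos hs) hu i
  have h2 : Real.exp (s ⬝ᵥ u) * (-(s ⬝ᵥ u) + 1) ≤ 1 := by
    calc Real.exp (s ⬝ᵥ u) * (-(s ⬝ᵥ u) + 1) ≤ Real.exp (s ⬝ᵥ u) * Real.exp (-(s ⬝ᵥ u)) :=
          mul_le_mul_of_nonneg_left (Real.add_one_le_exp _) (Real.exp_pos _).le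
      _ = 1 := by rw [← Real.exp_add, add_neg_cancel, Real.exp_zero]
  have h3 := mul_le_mul_of_nonneg_right h1 (Real.exp_pos (s ⬝ᵥ u)).le
  linarith

lemma laplaceFinite_smul_dirac_zero (c : ℝ) :
    LaplaceFinite (ENNReal.ofReal c • Measure.dirac (0 : Fin n → ℝ)) :=
  ⟨Measure.ae_smul_measure ((ae_dirac_iff measurableSet_Ici).2 le_rfl) _,
    fun s _ => (integrable_dirac (by simp)).smul_measure (by simp)⟩

lemma laplace_smul_dirac_zero {c : ℝ} (hc : 0 ≤ c) (s : Fin n → ℝ) :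
    laplace (ENNReal.ofReal c • Measure.dirac (0 : Fin n → ℝ)) s = c := by
  rw [laplace, integral_smul_measure, integral_dirac, ENNReal.toReal_ofReal hc]
  simp

/-- The derivative of `s ↦ c₀ + c₁ · s + ∫ (e^{s · u} - 1) dμ(u)`. -/
lemma hasFDerivAt_levyKhintchine {μ : Measure (Fin n → ℝ)} (hμ : ∀ᵐ u ∂μ, 0 ≤ u)
    (hint : ∀ s ∈ negOrthant n, Integrable (fun u => Real.exp (s ⬝ᵥ u) - 1) μ)
    (c₀ : ℝ) (c₁ : Fin n → ℝ) {s : Fin n → ℝ} (hs : s ∈ negOrthant n) :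
    HasFDerivAt (fun s => c₀ + c₁ ⬝ᵥ s + ∫ u, (Real.exp (s ⬝ᵥ u) - 1) ∂μ)
      (∑ i, (c₁ i + ∫ u, u i * Real.exp (s ⬝ᵥ u) ∂μ) •
        ContinuousLinearMap.proj (R := ℝ) (φ := fun _ : Fin n => ℝ) i) s := by
  have h1 := hasFDerivAt_integral_exp_sub 1 hμ hint (fun i s hs =>
    integrable_coord_mul_of_integrable_exp_sub_one hμ hs (hint s hs) i) hs
  have h2 := ((hasFDerivAt_dotProduct_left c₁ s).const_add c₀).add h1
  simp only [dotProduct_comm _ c₁] at h2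
  refine h2.congr_fderiv ?_
  simp only [add_smul, Finset.sum_add_distrib]

/-- The `i`-th partial derivative is the Laplace transform of `c_i δ_0 + u_i dμ`, hence absolutely
monotone; smoothness of `ψ` follows from that of its gradient. -/
lemma classT_of_levyKhintchine {ψ : (Fin n → ℝ) → ℝ} (hψ : ∀ s ∈ negOrthant n, ψ s ≤ 0)
    {μ : Measure (Fin n → ℝ)} (hμ : ∀ᵐ u ∂μ, 0 ≤ u) {c₀ : ℝ} {c₁ : Fin n → ℝ}
    (hc₁ : ∀ i, 0 ≤ c₁ i)
    (hint : ∀ s ∈ negOrthant n, Integrable (fun u => Real.exp (s ⬝ᵥ u) - 1) μ)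
    (hrep : ∀ s ∈ negOrthant n, ψ s = c₀ + c₁ ⬝ᵥ s + ∫ u, (Real.exp (s ⬝ᵥ u) - 1) ∂μ) :
    ClassT ψ := by
  set ν : Fin n → Measure (Fin n → ℝ) := fun i =>
    ENNReal.ofReal (c₁ i) • Measure.dirac 0 + coordMeasure μ i with hν
  have hcoord : ∀ i, LaplaceFinite (coordMeasure μ i) := fun i =>
    .of_integrable_coord hμ fun s hs =>
      integrable_coord_mul_of_integrable_exp_sub_one hμ hs (hint s hs) i
  have hνf : ∀ i, LaplaceFinite (ν i) := fun i =>
    (laplaceFinite_smul_dirac_zero _).add (hcoord i)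
  have hνl : ∀ i, ∀ s ∈ negOrthant n,
      laplace (ν i) s = c₁ i + ∫ u, u i * Real.exp (s ⬝ᵥ u) ∂μ := fun i s hs => by
    rw [hν, laplace_add_measure (laplaceFinite_smul_dirac_zero _) (hcoord i) hs,
      laplace_smul_dirac_zero (hc₁ i), laplace_coordMeasure hμ]
  have hder : ∀ s ∈ negOrthant n, HasFDerivAt ψ (∑ i, laplace (ν i) s •
      ContinuousLinearMap.proj (R := ℝ) (φ := fun _ : Fin n => ℝ) i) s := fun s hs => by
    have h := hasFDerivAt_levyKhintchine hμ hint c₀ c₁ hs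
    simp only [← hνl _ s hs] at h
    exact h.congr_of_eventuallyEq
      (eventually_of_mem (negOrthant_mem_nhds hs) fun t ht => hrep t ht)
  refine ⟨contDiffOn_infty.2 fun k => ?_, hψ, fun i => ?_⟩
  · exact (contDiffOn_of_hasFDerivAt_sum (k := k) hder fun i =>
      contDiffOn_infty.1 (hνf i).contDiffOn k).of_le le_self_add
  · refine (hνf i).absolutelyMonotone.congr fun s hs => ?_
    rw [partialDeriv, (hder s hs).fderiv, sum_smul_proj_apply_single]

theorem HasLevyKhintchine.classT {ψ : (Fin n → ℝ) → ℝ} (hψ : ∀ s ∈ negOrthant n, ψ s ≤ 0)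
    (h : HasLevyKhintchine ψ) : ClassT ψ := by
  obtain ⟨c₀, c₁, -, -, -, hc₁, μ, ⟨-, hμ⟩, -⟩ := h
  exact classT_of_levyKhintchine hψ
    ((ae_restrict_mem (measurableSet_puncturedOrthant n)).mono fun u hu => hu.1) hc₁
    (fun s hs => (hμ s hs).1) fun s hs => (hμ s hs).2

/-! ### From the class `T_n` to the Lévy–Khintchine formula -/

lemma partialDeriv_comm {f : (Fin n → ℝ) → ℝ} (hf : ContDiffOn ℝ ∞ f (negOrthant n))
    (i j : Fin n) :
    EqOn (partialDeriv i (partialDeriv j f)) (partialDeriv j (partialDeriv i f)) (negOrthant n) :=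
  fun s hs => by
    have hd : DifferentiableAt ℝ (fderiv ℝ f) s :=
      ((hf.fderiv_of_isOpen (isOpen_negOrthant n) (m := ∞) (by simp)).contDiffAt
        (negOrthant_mem_nhds hs)).differentiableAt (by simp)
    have h : ∀ i j, partialDeriv i (partialDeriv j f) s =
        fderiv ℝ (fderiv ℝ f) s (Pi.single i 1) (Pi.single j 1) := fun i j => by
      change fderiv ℝ (fun s => fderiv ℝ f s (Pi.single j 1)) s (Pi.single i 1) = _
      rw [fderiv_clm_apply hd (differentiableAt_const _)]
      simp
    have hsymm : IsSymmSndFDerivAt ℝ f s :=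
      ((contDiffOn_infty.1 hf 2).contDiffAt (negOrthant_mem_nhds hs)).isSymmSndFDerivAt (by simp)
    rw [h, h, hsymm.eq]

lemma sum_pos_of_nonneg_of_ne_zero {u : Fin n → ℝ} (hu : 0 ≤ u) (hu' : u ≠ 0) :
    0 < ∑ i, u i := by
  obtain ⟨i, hi⟩ := Function.ne_iff.1 hu'
  exact Finset.sum_pos' (fun i _ => hu i) ⟨i, Finset.mem_univ i, (hu i).lt_of_ne' hi⟩

lemma withDensity_finsetSum_left {α ι : Type*} [MeasurableSpace α] (s : Finset ι)
    (ν : ι → Measure α) (f : α → ENNReal) :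
    (∑ i ∈ s, ν i).withDensity f = ∑ i ∈ s, (ν i).withDensity f := by
  classical
  induction s using Finset.induction_on with
  | empty => simp
  | insert i s hi ih =>
    rw [Finset.sum_insert hi, Finset.sum_insert hi, withDensity_add_measure, ih]

lemma withDensity_finsetSum_right {α ι : Type*} [MeasurableSpace α] (s : Finset ι)
    (ν : Measure α) {f : ι → α → ENNReal} (hf : ∀ i, Measurable (f i)) :
    ν.withDensity (∑ i ∈ s, f i) = ∑ i ∈ s, ν.withDensity (f i) := by
  classical
  induction s using Finset.induction_on with
  | empty => simp
  | insert i s hi ih =>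
    rw [Finset.sum_insert hi, Finset.sum_insert hi, withDensity_add_left (hf i), ih]

/-- A family of measures with `u_j dν_i = u_i dν_j` comes from a single measure on the punctured
orthant. -/
lemma exists_coordMeasure_eq_restrict {ν : Fin n → Measure (Fin n → ℝ)}
    (hν : ∀ i, ∀ᵐ u ∂ν i, 0 ≤ u)
    (hsymm : ∀ i j, coordMeasure (ν i) j = coordMeasure (ν j) i) :
    ∃ μ : Measure (Fin n → ℝ), (∀ᵐ u ∂μ, 0 ≤ u) ∧ (∀ᵐ u ∂μ, u ≠ 0) ∧
      ∀ j, coordMeasure μ j = (ν j).restrict {0}ᶜ := by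
  set A : Set (Fin n → ℝ) := {0}ᶜ with hA
  have hAm : MeasurableSet A := (measurableSet_singleton 0).compl
  -- If `ν_i = u_i dμ` off the origin, then `Σ ν_i = (Σ u_i) dμ`, which forces `μ = (Σ u_i)⁻¹ Σ ν_i`
  -- there. The symmetry gives `u_j Σ ν_i = (Σ u_i) ν_j`, so this choice works.
  set w : (Fin n → ℝ) → ENNReal := fun u => ENNReal.ofReal (∑ i, u i)⁻¹ with hw
  have hwm : Measurable w := by fun_prop
  refine ⟨((∑ i, ν i).restrict A).withDensity w, ?_, ?_, fun j => ?_⟩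
  · refine (withDensity_absolutelyContinuous _ _).ae_le (ae_restrict_of_ae ?_)
    rw [ae_iff, Measure.coe_finsetSum, Finset.sum_apply]
    exact Finset.sum_eq_zero fun i _ => hν i
  · exact (withDensity_absolutelyContinuous _ _).ae_le
      ((ae_restrict_mem hAm).mono fun u hu => hu)
  · have hcm : ∀ i : Fin n, Measurable fun u : Fin n → ℝ => ENNReal.ofReal (u i) := fun i => by
      fun_prop
    have h1 : (∑ i, ν i).withDensity (fun u => ENNReal.ofReal (u j)) =
        (ν j).withDensity (∑ i, fun u => ENNReal.ofReal (u i)) := by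
      rw [withDensity_finsetSum_left, withDensity_finsetSum_right _ _ hcm]
      exact Finset.sum_congr rfl fun i _ => hsymm i j
    have h2 : (((∑ i, ν i).restrict A).withDensity w).withDensity (fun u => ENNReal.ofReal (u j)) =
        (((∑ i, ν i).withDensity (fun u => ENNReal.ofReal (u j))).restrict A).withDensity w := by
      rw [restrict_withDensity hAm, ← withDensity_mul _ hwm (hcm j),
        ← withDensity_mul _ (hcm j) hwm, mul_comm]
    have hSm : Measurable (∑ i, fun u : Fin n → ℝ => ENNReal.ofReal (u i)) := by
      rw [Finset.sum_fn]
      fun_prop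
    rw [coordMeasure, h2, h1, restrict_withDensity hAm, ← withDensity_mul _ hSm hwm]
    conv_rhs => rw [← withDensity_one (μ := (ν j).restrict A)]
    refine withDensity_congr_ae ?_
    filter_upwards [ae_restrict_mem hAm, ae_restrict_of_ae (hν j)] with u hu hu0
    have hpos := sum_pos_of_nonneg_of_ne_zero hu0 hu
    rw [Pi.mul_apply, Finset.sum_apply, ← ENNReal.ofReal_sum_of_nonneg fun i _ => hu0 i, hw,
      ← ENNReal.ofReal_mul hpos.le, mul_inv_cancel₀ hpos.ne']
    simp

/-- The first-order partial derivatives of a negative Bernstein function are the Laplace transforms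
of `c_i δ_0 + u_i dμ(u)`. -/
lemma ClassT.exists_partialDeriv_eq {ψ : (Fin n → ℝ) → ℝ} (hψ : ClassT ψ) :
    ∃ (c : Fin n → ℝ) (μ : Measure (Fin n → ℝ)), (∀ i, 0 ≤ c i) ∧ (∀ᵐ u ∂μ, 0 ≤ u) ∧
      (∀ᵐ u ∂μ, u ≠ 0) ∧ (∀ i, LaplaceFinite (coordMeasure μ i)) ∧
      ∀ i, ∀ s ∈ negOrthant n, partialDeriv i ψ s = c i + laplace (coordMeasure μ i) s := by
  choose ν hν hνψ using fun i => (hψ.2.2 i).exists_laplace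
  -- Both measures have the same Laplace transform, the mixed second derivative of `ψ`.
  have hsymm : ∀ i j, coordMeasure (ν i) j = coordMeasure (ν j) i := fun i j => by
    refine ((hν i).coordMeasure j).ext ((hν j).coordMeasure i) fun s hs => ?_
    rw [← (hν i).partialDeriv_eq j hs, ← (hν j).partialDeriv_eq i hs,
      ← partialDeriv_congr j (hνψ i) hs, ← partialDeriv_congr i (hνψ j) hs]
    exact partialDeriv_comm hψ.1 j i hs
  obtain ⟨μ, hμ, hμ', hμν⟩ := exists_coordMeasure_eq_restrict (fun i => (hν i).nonneg) hsymm
  -- The linear coefficient is the atom of `ν_i` at the origin, where `e^{s·u} = 1`.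
  refine ⟨fun i => (ν i).real {0}, μ, fun i => measureReal_nonneg, hμ, hμ', fun i => ?_,
    fun i s hs => ?_⟩
  · rw [hμν]
    exact ⟨ae_restrict_of_ae (hν i).nonneg, fun s hs => ((hν i).integrable s hs).integrableOn⟩
  · rw [hνψ i hs, hμν, laplace, laplace,
      ← integral_add_compl (measurableSet_singleton 0) ((hν i).integrable s hs),
      integral_singleton]
    simp

lemma integrableOn_exp_of_le_sum {μ : Measure (Fin n → ℝ)} {s : Fin n → ℝ}
    (h : ∀ i, Integrable (fun u => u i * Real.exp (s ⬝ᵥ u)) μ) {ε : ℝ} (hε : 0 < ε) :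
    IntegrableOn (fun u => Real.exp (s ⬝ᵥ u)) {u | ε ≤ ∑ i, u i} μ := by
  have hm : MeasurableSet {u : Fin n → ℝ | ε ≤ ∑ i, u i} :=
    measurableSet_le measurable_const (by fun_prop)
  refine Integrable.mono' (g := fun u => ε⁻¹ * ∑ i, u i * Real.exp (s ⬝ᵥ u))
    (((integrable_finsetSum _ fun i _ => h i).const_mul _).integrableOn)
    (by fun_prop : Measurable _).aestronglyMeasurable ?_
  filter_upwards [ae_restrict_mem hm] with u hu
  rw [Real.norm_of_nonneg (Real.exp_pos _).le, ← Finset.sum_mul, ← mul_assoc, inv_mul_eq_div]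
  exact le_mul_of_one_le_left (Real.exp_pos _).le ((one_le_div hε).2 hu)

/-- If `ψ ≤ 0` has the partial derivatives of `s ↦ c · s + ∫ (e^{s · u} - 1) dμ(u)`, then this
integral converges: the increments of `ψ` dominate those of the Laplace transforms of the
truncations of `μ`. -/
lemma integrable_exp_sub_one_of_partialDeriv_eq {ψ : (Fin n → ℝ) → ℝ}
    (hψ : ContDiffOn ℝ ∞ ψ (negOrthant n)) (hψ0 : ∀ s ∈ negOrthant n, ψ s ≤ 0)
    {c : Fin n → ℝ} (hc : ∀ i, 0 ≤ c i) {μ : Measure (Fin n → ℝ)} (hμ : ∀ᵐ u ∂μ, 0 ≤ u)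
    (hμ' : ∀ᵐ u ∂μ, u ≠ 0)
    (hint : ∀ i, ∀ s ∈ negOrthant n, Integrable (fun u => u i * Real.exp (s ⬝ᵥ u)) μ)
    (hder : ∀ i, ∀ s ∈ negOrthant n,
      partialDeriv i ψ s = c i + ∫ u, u i * Real.exp (s ⬝ᵥ u) ∂μ)
    {s : Fin n → ℝ} (hs : s ∈ negOrthant n) :
    Integrable (fun u => Real.exp (s ⬝ᵥ u) - 1) μ := by
  set B : ℕ → Set (Fin n → ℝ) := fun m => {u | 1 / ((m : ℝ) + 1) ≤ ∑ i, u i} with hB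
  have hBm : ∀ m, MeasurableSet (B m) := fun m =>
    measurableSet_le measurable_const (by fun_prop)
  have hfin : ∀ m, LaplaceFinite (μ.restrict (B m)) := fun m =>
    ⟨ae_restrict_of_ae hμ, fun s hs =>
      integrableOn_exp_of_le_sum (fun i => hint i s hs) (by positivity)⟩
  -- Away from the origin `μ` has a Laplace transform, whose gradient is at most that of `ψ`.
  have hmono : ∀ m, MonotoneOn (ψ - laplace (μ.restrict (B m))) (negOrthant n) := fun m => by
    refine monotoneOn_of_partialDeriv_nonneg (hψ.sub (hfin m).contDiffOn) fun i s hs => ?_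
    rw [partialDeriv_sub i hψ (hfin m).contDiffOn hs, Pi.sub_apply, hder i s hs,
      (hfin m).partialDeriv_eq i hs, laplace_coordMeasure (hfin m).nonneg]
    have : ∫ u in B m, u i * Real.exp (s ⬝ᵥ u) ∂μ ≤ ∫ u, u i * Real.exp (s ⬝ᵥ u) ∂μ :=
      setIntegral_le_integral (hint i s hs)
        (hμ.mono fun u hu => mul_nonneg (hu i) (Real.exp_pos _).le)
    linarith [hc i]
  -- Points increasing from `s` to `0` along a ray. The increment from `s` to `t m` is at most `ψ (t
  -- m) - ψ s ≤ -ψ s`.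
  set t : ℕ → Fin n → ℝ := fun m => (1 / ((m : ℝ) + 1)) • s with ht
  have htm : ∀ m, t m ∈ negOrthant n := fun m i =>
    mul_neg_of_pos_of_neg (by positivity) (hs i)
  have hst : ∀ m, s ≤ t m := fun m i => by
    have h1 : 1 / ((m : ℝ) + 1) ≤ 1 := by
      rw [div_le_one (by positivity)]
      linarith [(Nat.cast_nonneg m : (0 : ℝ) ≤ m)]
    have := mul_le_mul_of_nonpos_right h1 (hs i).le
    simpa [ht] using this
  set F : ℕ → (Fin n → ℝ) → ENNReal := fun m =>
    (B m).indicator fun u => ENNReal.ofReal (Real.exp (t m ⬝ᵥ u) - Real.exp (s ⬝ᵥ u)) with hF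
  have hFle : ∀ m, ∫⁻ u, F m u ∂μ ≤ ENNReal.ofReal (-ψ s) := fun m => by
    have hsub : Integrable (fun u => Real.exp (t m ⬝ᵥ u) - Real.exp (s ⬝ᵥ u)) (μ.restrict (B m)) :=
      ((hfin m).integrable _ (htm m)).sub ((hfin m).integrable _ hs)
    rw [hF, lintegral_indicator (hBm m), ← ofReal_integral_eq_lintegral_ofReal hsub
      (by
        filter_upwards [(hfin m).nonneg] with u hu
        exact sub_nonneg.2 (Real.exp_le_exp.2 (dotProduct_mono_left (hst m) hu)))]
    refine ENNReal.ofReal_le_ofReal ?_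
    rw [integral_sub ((hfin m).integrable _ (htm m)) ((hfin m).integrable _ hs)]
    have h1 := hmono m hs (htm m) (hst m)
    simp only [Pi.sub_apply, laplace] at h1
    linarith [hψ0 _ (htm m)]
  have hlim : ∀ᵐ u ∂μ, Tendsto (fun m => F m u) atTop
      (𝓝 (ENNReal.ofReal (1 - Real.exp (s ⬝ᵥ u)))) := by
    filter_upwards [hμ, hμ'] with u hu hu'
    have h0 : Tendsto (fun m : ℕ => 1 / ((m : ℝ) + 1)) atTop (𝓝 0) :=
      tendsto_one_div_add_atTop_nhds_zero_nat
    have h1 : Tendsto (fun m => Real.exp (t m ⬝ᵥ u) - Real.exp (s ⬝ᵥ u)) atTop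
        (𝓝 (1 - Real.exp (s ⬝ᵥ u))) := by
      simp only [ht, smul_dotProduct, smul_eq_mul]
      have := (Real.continuous_exp.tendsto _).comp (h0.mul_const (s ⬝ᵥ u))
      simp only [zero_mul, Real.exp_zero] at this
      exact this.sub_const _
    refine (ENNReal.tendsto_ofReal h1).congr' ?_
    filter_upwards [h0.eventually (gt_mem_nhds (sum_pos_of_nonneg_of_ne_zero hu hu'))] with m hm
    simp only [hF]
    rw [indicator_of_mem (show u ∈ B m from hm.le)]
  have hFm : ∀ m, Measurable (F m) := fun m => by
    refine Measurable.indicator ?_ (hBm m)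
    fun_prop
  -- Fatou's lemma, as the truncation and the endpoint `t m` move simultaneously.
  have hlint : ∫⁻ u, ENNReal.ofReal (1 - Real.exp (s ⬝ᵥ u)) ∂μ ≤ ENNReal.ofReal (-ψ s) := by
    calc ∫⁻ u, ENNReal.ofReal (1 - Real.exp (s ⬝ᵥ u)) ∂μ
        = ∫⁻ u, liminf (fun m => F m u) atTop ∂μ :=
          lintegral_congr_ae (hlim.mono fun u hu => hu.liminf_eq.symm)
      _ ≤ liminf (fun m => ∫⁻ u, F m u ∂μ) atTop := lintegral_liminf_le hFm
      _ ≤ ENNReal.ofReal (-ψ s) :=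
          liminf_le_of_le (by isBoundedDefault) fun b hb => by
            obtain ⟨m, hm⟩ := hb.exists
            exact hm.trans (hFle m)
  have hI : Integrable (fun u => 1 - Real.exp (s ⬝ᵥ u)) μ := by
    refine ⟨(by fun_prop : Measurable _).aestronglyMeasurable, ?_⟩
    rw [hasFiniteIntegral_iff_ofReal]
    · exact hlint.trans_lt ENNReal.ofReal_lt_top
    · filter_upwards [hμ] with u hu
      exact sub_nonneg.2 (Real.exp_le_one_iff.2
        (dotProduct_nonpos_of_nonpos (negOrthant_nonpos hs) hu))
  refine hI.neg.congr (Eventually.of_forall fun u => ?_)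
  simp

/-- The integral part of the representation vanishes at `-0`. -/
lemma tendsto_integral_exp_sub_one {μ : Measure (Fin n → ℝ)} (hμ : ∀ᵐ u ∂μ, 0 ≤ u)
    (hint : Integrable (fun u => Real.exp ((fun _ => -1) ⬝ᵥ u) - 1) μ) :
    Tendsto (fun s => ∫ u, (Real.exp (s ⬝ᵥ u) - 1) ∂μ) (𝓝[negOrthant n] 0) (𝓝 0) := by
  have hlim := tendsto_integral_filter_of_dominated_convergence (μ := μ)
    (F := fun s u => Real.exp (s ⬝ᵥ u) - 1) (f := fun _ => 0) (l := 𝓝[negOrthant n] 0)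
    (fun u => ‖Real.exp ((fun _ => -1) ⬝ᵥ u) - 1‖)
    (Eventually.of_forall fun s => (by fun_prop : Measurable _).aestronglyMeasurable)
    (by
      -- Close to the origin `s ≥ -1` coordinatewise, so the integrand at `-1` dominates.
      have h1 : ∀ᶠ s in 𝓝[negOrthant n] (0 : Fin n → ℝ), ∀ i, -1 < s i := by
        refine nhdsWithin_le_nhds (eventually_all.2 fun i => ?_)
        exact (continuous_apply i).tendsto (0 : Fin n → ℝ) |>.eventually (lt_mem_nhds (by simp))
      filter_upwards [h1, self_mem_nhdsWithin] with s hs1 hs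
      filter_upwards [hμ] with u hu
      have h2 := dotProduct_nonpos_of_nonpos (negOrthant_nonpos hs) hu
      have h3 : (fun _ => -1) ⬝ᵥ u ≤ s ⬝ᵥ u := dotProduct_mono_left (fun i => (hs1 i).le) hu
      rw [Real.norm_of_nonpos (by simpa using h2), Real.norm_of_nonpos (by
        simpa using h3.trans h2)]
      linarith [Real.exp_le_exp.2 h3])
    hint.norm
    (Eventually.of_forall fun u => by
      have hc : Continuous fun s : Fin n → ℝ => Real.exp (s ⬝ᵥ u) - 1 := by
        simp only [dotProduct_comm _ u]
        fun_prop
      have := (hc.tendsto 0).mono_left (nhdsWithin_le_nhds (s := negOrthant n))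
      simpa using this)
  simpa using hlim

/-- The Laplace transform of a measure without an atom at the origin vanishes at `-∞`. -/
lemma tendsto_laplace_atBot {ν : Measure (Fin n → ℝ)} (hν : LaplaceFinite ν)
    (hν' : ∀ᵐ u ∂ν, u ≠ 0) : Tendsto (laplace ν) atBot (𝓝 0) := by
  have hneg : ∀ m : ℕ, (fun _ => -((m : ℝ) + 1)) ∈ negOrthant n := fun m i => by
    have : (0 : ℝ) ≤ m := Nat.cast_nonneg m
    show -((m : ℝ) + 1) < 0
    linarith
  have hdot : ∀ (r : ℝ) (u : Fin n → ℝ), (fun _ => r) ⬝ᵥ u = r * ∑ i, u i := fun r u => by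
    rw [dotProduct, Finset.mul_sum]
  -- Dominated convergence along the diagonal; monotonicity of the transform then controls all
  -- points below a diagonal point, which is what `atBot` requires.
  have hseq : Tendsto (fun m : ℕ => laplace ν fun _ => -((m : ℝ) + 1)) atTop (𝓝 0) := by
    have h := tendsto_integral_of_dominated_convergence (μ := ν)
      (F := fun (m : ℕ) u => Real.exp ((fun _ => -((m : ℝ) + 1)) ⬝ᵥ u)) (f := fun _ => 0)
      (fun u => Real.exp ((fun _ => -(((0 : ℕ) : ℝ) + 1)) ⬝ᵥ u))
      (fun m => (by fun_prop : Measurable _).aestronglyMeasurable)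
      (hν.integrable _ (hneg 0))
      (fun m => by
        filter_upwards [hν.nonneg] with u hu
        rw [Real.norm_of_nonneg (Real.exp_pos _).le]
        refine Real.exp_le_exp.2 (dotProduct_mono_left (fun i => ?_) hu)
        have : (0 : ℝ) ≤ m := Nat.cast_nonneg m
        push_cast
        linarith)
      (by
        filter_upwards [hν.nonneg, hν'] with u hu hu'
        have hpos := sum_pos_of_nonneg_of_ne_zero hu hu'
        refine Real.tendsto_exp_atBot.comp ?_
        simp only [hdot]
        refine Tendsto.atBot_mul_const hpos (tendsto_neg_atTop_atBot.comp ?_)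
        exact tendsto_atTop_add_const_right _ _ tendsto_natCast_atTop_atTop)
    rwa [integral_zero] at h
  refine tendsto_order.2 ⟨fun b hb => Eventually.of_forall fun s => hb.trans_le
    (integral_nonneg fun u => (Real.exp_pos _).le), fun b hb => ?_⟩
  obtain ⟨m, hm⟩ := (hseq.eventually (gt_mem_nhds hb)).exists
  filter_upwards [eventually_le_atBot (fun _ : Fin n => -((m : ℝ) + 1))] with s hs
  exact (hν.absolutelyMonotone.monotoneOn (mem_negOrthant_of_le hs (hneg m)) (hneg m) hs).trans_lt
    hm

/-- The function `1 - e^{-Σ u_i}` controls both conditions: it is bounded below by a multiple of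
each `u_j` on the cube, and by a positive constant outside. -/
lemma isLevyMeasure_of_integrable {μ : Measure (Fin n → ℝ)} (hμ : ∀ᵐ u ∂μ, 0 ≤ u)
    (hμ' : ∀ᵐ u ∂μ, u ≠ 0)
    (hint : Integrable (fun u => Real.exp ((fun _ => -1) ⬝ᵥ u) - 1) μ) : IsLevyMeasure μ := by
  have hneg : (fun _ => -1) ∈ negOrthant n := fun i => by norm_num
  refine ⟨?_, ?_⟩
  · have : ∀ᵐ u ∂μ, u ∈ puncturedOrthant n := by
      filter_upwards [hμ, hμ'] with u hu hu'
      exact ⟨hu, hu'⟩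
    exact this
  filter_upwards [self_mem_nhdsWithin] with δ hδ
  have hδ0 : 0 < δ := hδ
  have hcube : MeasurableSet (cube n δ) := by
    simp only [cube, ofPred_forall]
    exact MeasurableSet.iInter fun i => (measurableSet_le measurable_const
      (measurable_pi_apply i)).inter (measurableSet_lt (measurable_pi_apply i) measurable_const)
  refine ⟨fun j => ?_, ?_⟩
  · have hj := integrable_coord_mul_of_integrable_exp_sub_one hμ hneg hint j
    refine Integrable.mono' ((hj.const_mul (Real.exp (n * δ))).integrableOn)
      (by fun_prop : Measurable _).aestronglyMeasurable ?_
    filter_upwards [ae_restrict_mem (hcube.diff (measurableSet_singleton 0))] with u hu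
    have hu0 : ∀ i, 0 ≤ u i := fun i => (hu.1 i).1
    rw [Real.norm_of_nonneg (hu0 j), mul_left_comm, ← Real.exp_add]
    refine le_mul_of_one_le_right (hu0 j) (Real.one_le_exp ?_)
    have h1 : ∑ i, u i ≤ n * δ := by
      simpa using Finset.sum_le_card_nsmul Finset.univ u δ fun i _ => (hu.1 i).2.le
    have h2 : (fun _ => (-1 : ℝ)) ⬝ᵥ u = -∑ i, u i := by simp [dotProduct]
    rw [h2]
    linarith
  -- Outside the cube some `u_i ≥ δ`, so the integrand is at least `1 - e^{-δ}` in absolute value,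
  -- and Markov's inequality applies.
  · refine (measure_mono fun u hu => ?_).trans_lt (hint.measure_norm_ge_lt_top
      (ε := 1 - Real.exp (-δ)) (by simpa using hδ0))
    obtain ⟨hu0, huc⟩ := hu
    have hex : ∃ i, δ ≤ u i := by
      by_contra! h
      exact huc fun i => ⟨hu0 i, h i⟩
    obtain ⟨i, hi⟩ := hex
    have h1 := mul_single_le_neg_dotProduct (negOrthant_nonpos hneg) hu0 i
    have h2 : Real.exp ((fun _ => -1) ⬝ᵥ u) ≤ Real.exp (-δ) := Real.exp_le_exp.2 (by linarith)
    show 1 - Real.exp (-δ) ≤ ‖_‖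
    rw [Real.norm_eq_abs]
    exact le_trans (by linarith) (neg_le_abs _)

lemma restrict_puncturedOrthant {μ : Measure (Fin n → ℝ)}
    (hμ : μ (puncturedOrthant n)ᶜ = 0) : μ.restrict (puncturedOrthant n) = μ :=
  Measure.restrict_eq_self_of_ae_mem (show ∀ᵐ u ∂μ, u ∈ puncturedOrthant n from hμ)

/-- The measure `(1 - e^{-Σ u_i}) dμ(u)`. -/
noncomputable def dampedMeasure (μ : Measure (Fin n → ℝ)) : Measure (Fin n → ℝ) :=
  μ.withDensity fun u => ENNReal.ofReal (1 - Real.exp ((fun _ => -1) ⬝ᵥ u))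

/-- The density is positive off the origin, so damping can be undone and loses no information on
`μ`. -/
lemma withDensity_dampedMeasure {μ : Measure (Fin n → ℝ)}
    (hμ : ∀ᵐ u ∂μ, u ∈ puncturedOrthant n) :
    (dampedMeasure μ).withDensity
      (fun u => ENNReal.ofReal (1 - Real.exp ((fun _ => -1) ⬝ᵥ u)))⁻¹ = μ := by
  refine withDensity_inv_same (by fun_prop) ?_ (Eventually.of_forall fun _ => ENNReal.ofReal_ne_top)
  filter_upwards [hμ] with u hu
  have h2 : (fun _ => (-1 : ℝ)) ⬝ᵥ u = -∑ i, u i := by simp [dotProduct]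
  rw [h2, Ne, ENNReal.ofReal_eq_zero, not_le, sub_pos, Real.exp_lt_one_iff, neg_lt_zero]
  exact sum_pos_of_nonneg_of_ne_zero hu.1 hu.2

lemma laplaceFinite_dampedMeasure {μ : Measure (Fin n → ℝ)} (hμ : ∀ᵐ u ∂μ, 0 ≤ u)
    (hint : Integrable (fun u => Real.exp ((fun _ => -1) ⬝ᵥ u) - 1) μ) :
    LaplaceFinite (dampedMeasure μ) := by
  have hnn : ∀ᵐ u ∂dampedMeasure μ, 0 ≤ u := (withDensity_absolutelyContinuous _ _).ae_le hμ
  have : IsFiniteMeasure (dampedMeasure μ) := by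
    refine isFiniteMeasure_withDensity_ofReal ?_
    exact (hint.neg.congr (Eventually.of_forall fun u => neg_sub _ _)).2
  refine ⟨hnn, fun s hs => Integrable.mono' (integrable_const 1)
    (by fun_prop : Measurable _).aestronglyMeasurable ?_⟩
  filter_upwards [hnn] with u hu
  rw [Real.norm_of_nonneg (Real.exp_pos _).le]
  exact Real.exp_le_one_iff.2 (dotProduct_nonpos_of_nonpos (negOrthant_nonpos hs) hu)

/-- Multiplying `e^{s·u}` by `1 - e^{-Σ u_i}` gives a difference of two exponentials, in which the
two terms `-1` cancel. -/
lemma laplace_dampedMeasure {μ : Measure (Fin n → ℝ)} (hμ : ∀ᵐ u ∂μ, 0 ≤ u)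
    (hint : ∀ s ∈ negOrthant n, Integrable (fun u => Real.exp (s ⬝ᵥ u) - 1) μ)
    {s : Fin n → ℝ} (hs : s ∈ negOrthant n) (hs' : s + (fun _ => -1) ∈ negOrthant n) :
    laplace (dampedMeasure μ) s = ∫ u, (Real.exp (s ⬝ᵥ u) - 1) ∂μ -
      ∫ u, (Real.exp ((s + fun _ => -1) ⬝ᵥ u) - 1) ∂μ := by
  rw [← integral_sub (hint s hs) (hint _ hs'), laplace, dampedMeasure,
    integral_withDensity_eq_integral_toReal_smul (by fun_prop)
      (Eventually.of_forall fun _ => ENNReal.ofReal_lt_top)]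
  refine integral_congr_ae ?_
  filter_upwards [hμ] with u hu
  have h1 : (fun _ => -1) ⬝ᵥ u ≤ 0 := dotProduct_nonpos_of_nonpos (fun i => by simp) hu
  rw [ENNReal.toReal_ofReal (sub_nonneg.2 (Real.exp_le_one_iff.2 h1)), add_dotProduct,
    Real.exp_add, smul_eq_mul]
  ring

/-- A Lévy measure may be infinite near the origin, so uniqueness of the Laplace transform is
applied to the damped measures. Their transforms are differences of values of `ψ`, up to the common
linear part. -/
lemma IsLevyMeasure.eq_of_represents {ψ : (Fin n → ℝ) → ℝ} {c₀ : ℝ} {c₁ : Fin n → ℝ}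
    {μ μ' : Measure (Fin n → ℝ)} (hμ : IsLevyMeasure μ) (hμ' : IsLevyMeasure μ')
    (h : Represents ψ c₀ c₁ μ) (h' : Represents ψ c₀ c₁ μ') : μ = μ' := by
  have hmem : ∀ᵐ u ∂μ, u ∈ puncturedOrthant n := hμ.1
  have hmem' : ∀ᵐ u ∂μ', u ∈ puncturedOrthant n := hμ'.1
  rw [← withDensity_dampedMeasure hmem, ← withDensity_dampedMeasure hmem']
  congr 1
  have hneg : (fun _ => -1) ∈ negOrthant n := fun i => by norm_num
  simp only [Represents, IntegrableOn, restrict_puncturedOrthant hμ.1] at h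
  simp only [Represents, IntegrableOn, restrict_puncturedOrthant hμ'.1] at h'
  have hnn := hmem.mono fun u hu => show 0 ≤ u from hu.1
  have hnn' := hmem'.mono fun u hu => show 0 ≤ u from hu.1
  refine (laplaceFinite_dampedMeasure hnn (h _ hneg).1).ext
    (laplaceFinite_dampedMeasure hnn' (h' _ hneg).1) fun s hs => ?_
  have hs' : s + (fun _ => -1) ∈ negOrthant n :=
    mem_negOrthant_of_le (add_le_of_nonpos_right fun i => by simp) hs
  rw [laplace_dampedMeasure hnn (fun s hs => (h s hs).1) hs hs',
    laplace_dampedMeasure hnn' (fun s hs => (h' s hs).1) hs hs']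
  linarith [(h s hs).2, (h _ hs').2, (h' s hs).2, (h' _ hs').2]

theorem ClassT.hasLevyKhintchine {ψ : (Fin n → ℝ) → ℝ} (hψ : ClassT ψ) :
    HasLevyKhintchine ψ := by
  obtain ⟨c, μ, hc, hμ, hμ', hfin, hder⟩ := hψ.exists_partialDeriv_eq
  have hcoord : ∀ i, ∀ s ∈ negOrthant n, Integrable (fun u => u i * Real.exp (s ⬝ᵥ u)) μ :=
    fun i s hs => by
      have h := (hfin i).integrable s hs
      rw [coordMeasure, integrable_withDensity_iff (by fun_prop)
        (Eventually.of_forall fun _ => ENNReal.ofReal_lt_top)] at h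
      refine h.congr ?_
      filter_upwards [hμ] with u hu
      rw [ENNReal.toReal_ofReal (hu i), mul_comm]
  have hder' : ∀ i, ∀ s ∈ negOrthant n,
      partialDeriv i ψ s = c i + ∫ u, u i * Real.exp (s ⬝ᵥ u) ∂μ := fun i s hs => by
    rw [hder i s hs, laplace_coordMeasure hμ]
  have hint : ∀ s ∈ negOrthant n, Integrable (fun u => Real.exp (s ⬝ᵥ u) - 1) μ :=
    fun s hs => integrable_exp_sub_one_of_partialDeriv_eq hψ.1 hψ.2.1 hc hμ hμ' hcoord hder' hs
  have hneg : (fun _ => -1) ∈ negOrthant n := fun i => by norm_num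
  set Ψ : (Fin n → ℝ) → ℝ := fun s => 0 + c ⬝ᵥ s + ∫ u, (Real.exp (s ⬝ᵥ u) - 1) ∂μ with hΨ
  have hΨd : ∀ s ∈ negOrthant n, HasFDerivAt Ψ (fderiv ℝ ψ s) s := fun s hs => by
    refine (hasFDerivAt_levyKhintchine hμ hint 0 c hs).congr_fderiv ?_
    refine ContinuousLinearMap.ext fun v => ?_
    rw [sum_smul_proj_apply, fderiv_apply_eq_sum]
    exact Finset.sum_congr rfl fun i _ => by rw [hder' i s hs, mul_comm]
  have hψd : ∀ s ∈ negOrthant n, HasFDerivAt ψ (fderiv ℝ ψ s) s := fun s hs =>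
    (differentiableAt_of_contDiffOn hψ.1 hs).hasFDerivAt
  -- `ψ` and `Ψ` have the same gradient on a connected open set, so they differ by a constant.
  obtain ⟨c₀, hc₀⟩ := (isOpen_negOrthant n).exists_is_const_of_fderiv_eq_zero
    (convex_negOrthant n).isPreconnected (f := ψ - Ψ)
    (fun s hs => ((hψd s hs).sub (hΨd s hs)).differentiableAt.differentiableWithinAt)
    (fun s hs => by rw [((hψd s hs).sub (hΨd s hs)).fderiv, sub_self]; rfl)
  have hrep : ∀ s ∈ negOrthant n, ψ s = c₀ + c ⬝ᵥ s + ∫ u, (Real.exp (s ⬝ᵥ u) - 1) ∂μ :=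
    fun s hs => by
      have := hc₀ s hs
      simp only [Pi.sub_apply, hΨ] at this
      linarith
  have hlevy := isLevyMeasure_of_integrable hμ hμ' (hint _ hneg)
  have hR : Represents ψ c₀ c μ := by
    simp only [Represents, IntegrableOn, restrict_puncturedOrthant hlevy.1]
    exact fun s hs => ⟨hint s hs, hrep s hs⟩
  refine ⟨c₀, c, ?_, fun s hs => (hψd s hs).differentiableAt.differentiableWithinAt, fun i => ?_,
    hc, μ, ⟨hlevy, hR⟩, fun μ' h' => h'.1.eq_of_represents hlevy h'.2 hR⟩
  · have h1 : Tendsto (fun s : Fin n → ℝ => c₀ + c ⬝ᵥ s) (𝓝[negOrthant n] 0) (𝓝 c₀) := by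
      have hcont : Continuous fun s : Fin n → ℝ => c₀ + c ⬝ᵥ s := by fun_prop
      have := (hcont.tendsto 0).mono_left (nhdsWithin_le_nhds (s := negOrthant n))
      simpa using this
    have h2 := h1.add (tendsto_integral_exp_sub_one hμ (hint _ hneg))
    rw [add_zero] at h2
    exact h2.congr' (eventually_of_mem self_mem_nhdsWithin fun s hs => (hrep s hs).symm)
  · have h1 := (tendsto_laplace_atBot (hfin i)
      ((withDensity_absolutelyContinuous _ _).ae_le hμ')).const_add (c i)
    rw [add_zero] at h1
    refine h1.congr' ?_
    filter_upwards [eventually_le_atBot (fun _ : Fin n => (-1 : ℝ))] with s hs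
    exact (hder i s (mem_negOrthant_of_le hs hneg)).symm

/-! ### Composition of absolutely monotone functions -/

lemma partialDeriv_const (i : Fin n) (c : ℝ) :
    partialDeriv i (fun _ : Fin n → ℝ => c) = fun _ => 0 := by
  funext s
  simp [partialDeriv]

lemma absolutelyMonotone_const {c : ℝ} (hc : 0 ≤ c) :
    AbsolutelyMonotone fun _ : Fin n → ℝ => c := by
  refine absolutelyMonotone_iff_forall_upTo.2 fun N => ?_
  induction N generalizing c with
  | zero => exact absolutelyMonotoneUpTo_zero_iff.2 ⟨contDiffOn_const, fun _ _ => hc⟩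
  | succ N ih =>
    refine absolutelyMonotoneUpTo_succ_iff.2 ⟨contDiffOn_const, fun _ _ => hc, fun i => ?_⟩
    rw [partialDeriv_const]
    exact ih le_rfl

lemma absolutelyMonotone_partialDeriv_apply (i j : Fin n) :
    AbsolutelyMonotone (partialDeriv j fun s : Fin n → ℝ => s i) := by
  have h : partialDeriv j (fun s : Fin n → ℝ => s i) =
      fun _ => (Pi.single j 1 : Fin n → ℝ) i := by
    funext s
    rw [partialDeriv, (hasFDerivAt_apply i s).fderiv]
    rfl
  rw [h]
  refine absolutelyMonotone_const ?_
  exact (Pi.single_nonneg.2 zero_le_one : (0 : Fin n → ℝ) ≤ Pi.single j 1) i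

lemma AbsolutelyMonotoneUpTo.sum {N : ℕ} {ι : Type*} (S : Finset ι)
    {f : ι → (Fin n → ℝ) → ℝ} (hf : ∀ i ∈ S, AbsolutelyMonotoneUpTo N (f i)) :
    AbsolutelyMonotoneUpTo N (∑ i ∈ S, f i) := by
  classical
  induction S using Finset.induction_on with
  | empty => exact (absolutelyMonotone_const le_rfl).upTo N
  | insert i S hi ih =>
    rw [Finset.sum_insert hi]
    exact (hf i (Finset.mem_insert_self i S)).add
      (ih fun k hk => hf k (Finset.mem_insert_of_mem hk))

lemma partialDeriv_comp {p : ℕ} {g : (Fin n → ℝ) → ℝ} (hg : ContDiffOn ℝ ∞ g (negOrthant n))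
    {Φ : (Fin p → ℝ) → Fin n → ℝ} (hΦ : ∀ i, ContDiffOn ℝ ∞ (fun x => Φ x i) (negOrthant p))
    (hmaps : MapsTo Φ (negOrthant p) (negOrthant n)) (j : Fin p) :
    EqOn (partialDeriv j (g ∘ Φ))
      (∑ i, partialDeriv j (fun x => Φ x i) * (partialDeriv i g ∘ Φ)) (negOrthant p) :=
  fun x hx => by
    have hΦd : DifferentiableAt ℝ Φ x :=
      ((contDiffOn_pi.2 hΦ).contDiffAt (negOrthant_mem_nhds hx)).differentiableAt (by simp)
    rw [partialDeriv, fderiv_comp x (differentiableAt_of_contDiffOn hg (hmaps hx)) hΦd,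
      ContinuousLinearMap.comp_apply, fderiv_apply_eq_sum, Finset.sum_apply]
    refine Finset.sum_congr rfl fun i _ => ?_
    rw [Pi.mul_apply, partialDeriv, Function.comp_apply]
    congr 1
    rw [partialDeriv, (hasFDerivAt_pi'.1 hΦd.hasFDerivAt i).fderiv]
    rfl

/-- Composition with a map whose components have absolutely monotone first-order partial
derivatives. -/
theorem AbsolutelyMonotone.comp {p : ℕ} {f : (Fin n → ℝ) → ℝ} (hf : AbsolutelyMonotone f)
    {Φ : (Fin p → ℝ) → Fin n → ℝ} (hΦ : ∀ i, ContDiffOn ℝ ∞ (fun x => Φ x i) (negOrthant p))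
    (hΦ' : ∀ i j, AbsolutelyMonotone (Bernstein.partialDeriv j fun x => Φ x i))
    (hmaps : MapsTo Φ (negOrthant p) (negOrthant n)) : AbsolutelyMonotone (f ∘ Φ) := by
  refine absolutelyMonotone_iff_forall_upTo.2 fun N => ?_
  have hΦc : ContDiffOn ℝ ∞ Φ (negOrthant p) := contDiffOn_pi.2 hΦ
  induction N generalizing f with
  | zero =>
    exact absolutelyMonotoneUpTo_zero_iff.2
      ⟨hf.1.comp hΦc hmaps, fun x hx => hf.nonneg (hmaps hx)⟩
  | succ N ih =>
    refine absolutelyMonotoneUpTo_succ_iff.2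
      ⟨hf.1.comp hΦc hmaps, fun x hx => hf.nonneg (hmaps hx), fun j => ?_⟩
    exact (AbsolutelyMonotoneUpTo.sum _ fun i _ =>
      ((hΦ' i j).upTo N).mul (ih (hf.partialDeriv i))).congr (partialDeriv_comp hf.1 hΦ hmaps j)

lemma absolutelyMonotone_partialDeriv_comp {p : ℕ} {g : (Fin n → ℝ) → ℝ}
    (hg : ContDiffOn ℝ ∞ g (negOrthant n)) (hg' : ∀ i, AbsolutelyMonotone (partialDeriv i g))
    {Φ : (Fin p → ℝ) → Fin n → ℝ} (hΦ : ∀ i, ContDiffOn ℝ ∞ (fun x => Φ x i) (negOrthant p))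
    (hΦ' : ∀ i j, AbsolutelyMonotone (partialDeriv j fun x => Φ x i))
    (hmaps : MapsTo Φ (negOrthant p) (negOrthant n)) (j : Fin p) :
    AbsolutelyMonotone (partialDeriv j (g ∘ Φ)) :=
  absolutelyMonotone_iff_forall_upTo.2 fun N => (AbsolutelyMonotoneUpTo.sum _ fun i _ =>
    ((hΦ' i j).upTo N).mul (((hg' i).comp hΦ hΦ' hmaps).upTo N)).congr
      (partialDeriv_comp hg hΦ hmaps j)

/-- Composition with a selection of coordinates. -/
lemma AbsolutelyMonotone.comp_reindex {p : ℕ} {f : (Fin n → ℝ) → ℝ} (hf : AbsolutelyMonotone f)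
    (σ : Fin n → Fin p) : AbsolutelyMonotone fun x : Fin p → ℝ => f fun i => x (σ i) :=
  hf.comp (Φ := fun x i => x (σ i)) (fun i => (contDiff_apply ℝ ℝ (σ i)).contDiffOn)
    (fun i j => absolutelyMonotone_partialDeriv_apply (σ i) j) fun _ hx i => hx (σ i)

/-! ### Testing on exponentials: from the substitution property to the class `T_n` -/

lemma absolutelyMonotone_of_comp_castAdd {k : ℕ} {h : (Fin n → ℝ) → ℝ}
    (hh : AbsolutelyMonotone fun x : Fin (n + k) → ℝ => h fun i => x (Fin.castAdd k i)) :
    AbsolutelyMonotone h := by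
  -- The last `k` variables are frozen at the interior value `-1`.
  have key := hh.comp (Φ := fun s : Fin n → ℝ => Fin.append s fun _ : Fin k => (-1 : ℝ))
    (fun i => by
      refine Fin.addCases (fun i => ?_) (fun j => ?_) i
      · simp only [Fin.append_left]
        exact (contDiff_apply ℝ ℝ i).contDiffOn
      · simp only [Fin.append_right]
        exact contDiffOn_const)
    (fun i j => by
      refine Fin.addCases (fun i => ?_) (fun i => ?_) i
      · simp only [Fin.append_left]
        exact absolutelyMonotone_partialDeriv_apply i j
      · simp only [Fin.append_right, partialDeriv_const]
        exact absolutelyMonotone_const le_rfl)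
    (fun s hs i => by
      refine Fin.addCases (fun i => ?_) (fun i => ?_) i
      · simpa only [Fin.append_left] using hs i
      · simp)
  refine key.congr fun s _ => ?_
  simp

lemma absolutelyMonotone_exp_mul_apply (i : Fin n) {ε : ℝ} (hε : 0 ≤ ε) :
    AbsolutelyMonotone fun x : Fin n → ℝ => Real.exp (ε * x i) := by
  have hν : LaplaceFinite (Measure.dirac (Pi.single i ε : Fin n → ℝ)) :=
    ⟨(ae_dirac_iff measurableSet_Ici).2 (Pi.single_nonneg.2 hε),
      fun s _ => integrable_dirac (by simp)⟩
  refine hν.absolutelyMonotone.congr fun s _ => ?_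
  rw [laplace, integral_dirac, dotProduct_single, mul_comm]

/-- The test function `e^{ε x_0}` is continuous up to `x_0 = 0`, so it is admissible whether or not
`ψ` takes the value `0`. -/
lemma PreservesAbsolutelyMonotone.absolutelyMonotone_exp {k : ℕ} {ψ : (Fin n → ℝ) → ℝ}
    (h : PreservesAbsolutelyMonotone k ψ) {ε : ℝ} (hε : 0 ≤ ε) :
    AbsolutelyMonotone fun s => Real.exp (ε * ψ s) := by
  refine absolutelyMonotone_of_comp_castAdd (k := k) ?_
  have := h _ (absolutelyMonotone_exp_mul_apply (0 : Fin (k + 1)) hε) fun _ r _ => by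
    simp only [Fin.cons_zero]
    have hc : Continuous fun x : ℝ => Real.exp (ε * x) := by fun_prop
    exact (hc.tendsto 0).mono_left nhdsWithin_le_nhds
  exact this

section ExpLimit

variable {ψ : (Fin n → ℝ) → ℝ}

lemma contDiffOn_exp_mul (hψ : ContDiffOn ℝ ∞ ψ (negOrthant n)) (ε : ℝ) :
    ContDiffOn ℝ ∞ (fun s => Real.exp (ε * ψ s)) (negOrthant n) :=
  (contDiffOn_const.mul hψ).exp

lemma partialDeriv_exp_mul (hψ : ContDiffOn ℝ ∞ ψ (negOrthant n)) (ε : ℝ) (i : Fin n) :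
    EqOn (partialDeriv i fun s => Real.exp (ε * ψ s))
      (ε • ((fun s => Real.exp (ε * ψ s)) * partialDeriv i ψ)) (negOrthant n) := fun s hs => by
  have hd := ((differentiableAt_of_contDiffOn hψ hs).hasFDerivAt.const_mul ε).exp
  rw [partialDeriv, hd.fderiv]
  simp [partialDeriv]
  ring

/-- Each derivative that falls on the exponential brings out a factor `ε`, so only the term with all
derivatives on `g` survives. The induction varies `g`, because the innermost derivative replaces it
by `∂_j g` and `g ∂_j ψ`. -/
lemma tendsto_iterPartialDeriv_exp_mul (hψ : ContDiffOn ℝ ∞ ψ (negOrthant n))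
    (l : List (Fin n)) {g : (Fin n → ℝ) → ℝ} (hg : ContDiffOn ℝ ∞ g (negOrthant n))
    {s : Fin n → ℝ} (hs : s ∈ negOrthant n) :
    Tendsto (fun ε : ℝ => iterPartialDeriv l ((fun s => Real.exp (ε * ψ s)) * g) s) (𝓝[>] 0)
      (𝓝 (iterPartialDeriv l g s)) := by
  have hid : Tendsto (fun ε : ℝ => ε) (𝓝[>] 0) (𝓝 0) :=
    tendsto_id.mono_left nhdsWithin_le_nhds
  induction l using List.reverseRecOn generalizing g with
  | nil =>
    have hc : Continuous fun ε : ℝ => Real.exp (ε * ψ s) * g s := by fun_prop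
    have := (hc.tendsto 0).mono_left (nhdsWithin_le_nhds (s := Ioi 0))
    simpa [iterPartialDeriv] using this
  | append_singleton l j ih =>
    have hj := contDiffOn_partialDeriv j hg
    have hg' : ContDiffOn ℝ ∞ (g * partialDeriv j ψ) (negOrthant n) :=
      hg.mul (contDiffOn_partialDeriv j hψ)
    have hexp : ∀ ε : ℝ, iterPartialDeriv (l ++ [j]) ((fun s => Real.exp (ε * ψ s)) * g) s =
        iterPartialDeriv l ((fun s => Real.exp (ε * ψ s)) * partialDeriv j g) s +
          ε * iterPartialDeriv l ((fun s => Real.exp (ε * ψ s)) * (g * partialDeriv j ψ)) s :=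
      fun ε => by
        have hE := contDiffOn_exp_mul hψ ε
        have h2 : ContDiffOn ℝ ∞ ((fun s => Real.exp (ε * ψ s)) * partialDeriv j g)
            (negOrthant n) := hE.mul hj
        have h3 : ContDiffOn ℝ ∞ ((fun s => Real.exp (ε * ψ s)) * (g * partialDeriv j ψ))
            (negOrthant n) := hE.mul hg'
        have h4 : ContDiffOn ℝ ∞ (ε • ((fun s => Real.exp (ε * ψ s)) * (g * partialDeriv j ψ)))
            (negOrthant n) := contDiffOn_const.smul h3
        have h1 : EqOn (partialDeriv j ((fun s => Real.exp (ε * ψ s)) * g))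
            ((fun s => Real.exp (ε * ψ s)) * partialDeriv j g +
              ε • ((fun s => Real.exp (ε * ψ s)) * (g * partialDeriv j ψ))) (negOrthant n) :=
          fun t ht => by
            rw [partialDeriv_mul j hE hg ht, Pi.add_apply, Pi.add_apply, Pi.mul_apply (f := g),
              partialDeriv_exp_mul hψ ε j ht]
            simp only [Pi.smul_apply, Pi.mul_apply, smul_eq_mul]
            ring
        rw [iterPartialDeriv_concat, iterPartialDeriv_congr l h1 hs,
          iterPartialDeriv_add l h2 h4 hs, Pi.add_apply, iterPartialDeriv_smul l ε h3 hs, Pi.smul_apply, smul_eq_mul]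
    simp only [hexp]
    have := (ih hj).add (hid.mul (ih hg'))
    rw [zero_mul, add_zero, ← iterPartialDeriv_concat] at this
    exact this

end ExpLimit

theorem PreservesAbsolutelyMonotone.classT {k : ℕ} {ψ : (Fin n → ℝ) → ℝ}
    (hψ0 : ∀ s ∈ negOrthant n, ψ s ≤ 0) (h : PreservesAbsolutelyMonotone k ψ) : ClassT ψ := by
  have hψ : ContDiffOn ℝ ∞ ψ (negOrthant n) := by
    -- Smoothness of `ψ` is recovered as that of the logarithm of `e^ψ`.
    refine ((h.absolutelyMonotone_exp zero_le_one).1.log fun s _ => (Real.exp_pos _).ne').congr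
      fun s _ => ?_
    rw [Real.log_exp, one_mul]
  refine ⟨hψ, hψ0, fun i => ⟨contDiffOn_partialDeriv i hψ, fun l s hs => ?_⟩⟩
  refine ge_of_tendsto
    (tendsto_iterPartialDeriv_exp_mul hψ l (contDiffOn_partialDeriv i hψ) hs) ?_
  filter_upwards [self_mem_nhdsWithin] with ε hε
  have hε0 : 0 < ε := hε
  have h2 : ContDiffOn ℝ ∞ ((fun s => Real.exp (ε * ψ s)) * partialDeriv i ψ) (negOrthant n) :=
    (contDiffOn_exp_mul hψ ε).mul (contDiffOn_partialDeriv i hψ)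
  have h1 := (h.absolutelyMonotone_exp hε0.le).2 (l ++ [i]) s hs
  -- One derivative of `e^{εψ}` in the direction `i` yields `ε e^{εψ} ∂_i ψ`; the positive factor
  -- `ε` is then cancelled.
  rw [iterPartialDeriv_concat, iterPartialDeriv_congr l (partialDeriv_exp_mul hψ ε i) hs,
    iterPartialDeriv_smul l ε h2 hs, Pi.smul_apply, smul_eq_mul] at h1
  exact (mul_nonneg_iff_of_pos_left hε0).1 h1

/-! ### Vanishing functions, boundary values and the substitution property -/

/-- A negative Bernstein function that vanishes somewhere vanishes identically. -/
lemma ClassT.eqOn_zero {ψ : (Fin n → ℝ) → ℝ} (hψ : ClassT ψ)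
    (h : ∃ s ∈ negOrthant n, ψ s = 0) : EqOn ψ 0 (negOrthant n) := by
  obtain ⟨s₀, hs₀, hψs₀⟩ := h
  -- As `ψ ≤ 0`, a zero is a maximum, so the gradient vanishes there. A Laplace transform with a
  -- zero comes from the zero measure, so the gradient vanishes everywhere.
  have hmax : IsLocalMax ψ s₀ := eventually_of_mem (negOrthant_mem_nhds hs₀) fun s hs => by
    rw [hψs₀]
    exact hψ.2.1 s hs
  have hzero : ∀ i, EqOn (partialDeriv i ψ) 0 (negOrthant n) := fun i s hs => by
    obtain ⟨ν, hν, hνψ⟩ := (hψ.2.2 i).exists_laplace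
    have h0 : laplace ν s₀ = 0 := by
      rw [← hνψ hs₀, partialDeriv, hmax.fderiv_eq_zero]
      rfl
    rw [laplace, integral_eq_zero_iff_of_nonneg (fun u => (Real.exp_pos _).le)
      (hν.integrable s₀ hs₀)] at h0
    have hν0 : ν = 0 := by
      rw [← ae_eq_bot, ← eventually_false_iff_eq_bot]
      exact h0.mono fun u hu => (Real.exp_pos _).ne' hu
    rw [hνψ hs, hν0]
    simp [laplace]
  intro s hs
  rw [Pi.zero_apply, ← hψs₀]
  exact (isOpen_negOrthant n).is_const_of_fderiv_eq_zero
    (convex_negOrthant n).isPreconnected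
    (fun s hs => (differentiableAt_of_contDiffOn hψ.1 hs).differentiableWithinAt)
    (fun s hs => ContinuousLinearMap.ext fun v => by
      rw [fderiv_apply_eq_sum]
      exact Finset.sum_eq_zero fun i _ => by rw [hzero i hs, Pi.zero_apply, mul_zero])
    hs hs₀

lemma cons_dotProduct_eq {k : ℕ} (x : ℝ) (r : Fin k → ℝ) (u : Fin (k + 1) → ℝ) :
    (Fin.cons x r : Fin (k + 1) → ℝ) ⬝ᵥ u = x * u 0 + r ⬝ᵥ Fin.tail u := by
  simp [dotProduct, Fin.sum_univ_succ, Fin.tail]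

lemma cons_mem_negOrthant {k : ℕ} {x : ℝ} (hx : x < 0) {r : Fin k → ℝ} (hr : r ∈ negOrthant k) :
    (Fin.cons x r : Fin (k + 1) → ℝ) ∈ negOrthant (k + 1) := fun i => by
  refine Fin.cases ?_ (fun j => ?_) i
  · simpa using hx
  · simpa using hr j

lemma measurable_tail (k : ℕ) : Measurable (Fin.tail : (Fin (k + 1) → ℝ) → Fin k → ℝ) :=
  measurable_pi_lambda _ fun _ => measurable_pi_apply _

/-- The limit of an absolutely monotone function at a face of the orthant, if it is finite, is
absolutely monotone. -/
lemma AbsolutelyMonotone.boundary {k : ℕ} {f : (Fin (k + 1) → ℝ) → ℝ}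
    (hf : AbsolutelyMonotone f)
    (hlim : ∀ r ∈ negOrthant k,
      Tendsto (fun x : ℝ => f (Fin.cons x r)) (𝓝[<] 0) (𝓝 (f (Fin.cons 0 r)))) :
    AbsolutelyMonotone fun r : Fin k → ℝ => f (Fin.cons 0 r) := by
  obtain ⟨ν, hν, hνf⟩ := hf.exists_laplace
  have hx : ∀ m : ℕ, -(1 / ((m : ℝ) + 1)) < 0 := fun m => neg_lt_zero.2 (by positivity)
  have hx0 : Tendsto (fun m : ℕ => -(1 / ((m : ℝ) + 1))) atTop (𝓝 0) := by
    simpa using (tendsto_one_div_add_atTop_nhds_zero_nat (𝕜 := ℝ)).neg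
  have hx0' : Tendsto (fun m : ℕ => -(1 / ((m : ℝ) + 1))) atTop (𝓝[<] 0) :=
    tendsto_nhdsWithin_iff.2 ⟨hx0, Eventually.of_forall hx⟩
  have hpt : ∀ (r : Fin k → ℝ) (u : Fin (k + 1) → ℝ), Tendsto
      (fun m : ℕ => Real.exp ((Fin.cons (-(1 / ((m : ℝ) + 1))) r : Fin (k + 1) → ℝ) ⬝ᵥ u)) atTop
      (𝓝 (Real.exp (r ⬝ᵥ Fin.tail u))) := fun r u => by
    simp only [cons_dotProduct_eq]
    have := (hx0.mul_const (u 0)).add_const (r ⬝ᵥ Fin.tail u)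
    rw [zero_mul, zero_add] at this
    exact (Real.continuous_exp.tendsto _).comp this
  have hmeas : ∀ r : Fin k → ℝ, Measurable fun u : Fin (k + 1) → ℝ =>
      Real.exp (r ⬝ᵥ Fin.tail u) := fun r =>
    Real.measurable_exp.comp ((measurable_dotProduct_left r).comp (measurable_tail k))
  -- Fatou's lemma turns finiteness of the boundary limit into integrability at `x = 0`. This
  -- integrand then dominates those for `x < 0`, so the limit may be taken under the integral.
  have hint : ∀ r ∈ negOrthant k, Integrable (fun u => Real.exp (r ⬝ᵥ Fin.tail u)) ν :=
    fun r hr => by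
      refine ⟨(hmeas r).aestronglyMeasurable, ?_⟩
      rw [hasFiniteIntegral_iff_ofReal (Eventually.of_forall fun u => (Real.exp_pos _).le)]
      have hval : ∀ m : ℕ, ∫⁻ u, ENNReal.ofReal (Real.exp
          ((Fin.cons (-(1 / ((m : ℝ) + 1))) r : Fin (k + 1) → ℝ) ⬝ᵥ u)) ∂ν =
          ENNReal.ofReal (f (Fin.cons (-(1 / ((m : ℝ) + 1))) r)) := fun m => by
        have hm := cons_mem_negOrthant (hx m) hr
        rw [hνf hm, laplace, ofReal_integral_eq_lintegral_ofReal (hν.integrable _ hm)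
          (Eventually.of_forall fun u => (Real.exp_pos _).le)]
      calc ∫⁻ u, ENNReal.ofReal (Real.exp (r ⬝ᵥ Fin.tail u)) ∂ν
          = ∫⁻ u, liminf (fun m : ℕ => ENNReal.ofReal (Real.exp
              ((Fin.cons (-(1 / ((m : ℝ) + 1))) r : Fin (k + 1) → ℝ) ⬝ᵥ u))) atTop ∂ν :=
            lintegral_congr fun u => (ENNReal.tendsto_ofReal (hpt r u)).liminf_eq.symm
        _ ≤ liminf (fun m : ℕ => ∫⁻ u, ENNReal.ofReal (Real.exp
              ((Fin.cons (-(1 / ((m : ℝ) + 1))) r : Fin (k + 1) → ℝ) ⬝ᵥ u)) ∂ν) atTop :=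
            lintegral_liminf_le fun m => by fun_prop
        _ = ENNReal.ofReal (f (Fin.cons 0 r)) := by
            simp only [hval]
            exact (ENNReal.tendsto_ofReal ((hlim r hr).comp hx0')).liminf_eq
        _ < ⊤ := ENNReal.ofReal_lt_top
  -- At `x = 0` the first coordinate of `u` no longer matters, so the boundary function is the
  -- Laplace transform of the projection of `ν`.
  have hfin : LaplaceFinite (ν.map Fin.tail) := by
    refine ⟨(ae_map_iff (measurable_tail k).aemeasurable measurableSet_Ici).2
      (hν.nonneg.mono fun u hu j => hu j.succ), fun r hr => ?_⟩
    rw [integrable_map_measure (by fun_prop : Measurable _).aestronglyMeasurable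
      (measurable_tail k).aemeasurable]
    exact hint r hr
  refine hfin.absolutelyMonotone.congr fun r hr => ?_
  have h1 := tendsto_integral_of_dominated_convergence (μ := ν)
    (F := fun (m : ℕ) u => Real.exp
      ((Fin.cons (-(1 / ((m : ℝ) + 1))) r : Fin (k + 1) → ℝ) ⬝ᵥ u)) _
    (fun m => (by fun_prop : Measurable _).aestronglyMeasurable) (hint r hr)
    (fun m => by
      filter_upwards [hν.nonneg] with u hu
      rw [Real.norm_of_nonneg (Real.exp_pos _).le, cons_dotProduct_eq]
      refine Real.exp_le_exp.2 ?_
      linarith [mul_nonpos_of_nonpos_of_nonneg (hx m).le (hu 0)])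
    (Eventually.of_forall fun u => hpt r u)
  have h2 := (hlim r hr).comp hx0'
  have h3 : laplace (ν.map Fin.tail) r = ∫ u, Real.exp (r ⬝ᵥ Fin.tail u) ∂ν := by
    rw [laplace, integral_map (measurable_tail k).aemeasurable
      (by fun_prop : Measurable _).aestronglyMeasurable]
  rw [h3]
  refine tendsto_nhds_unique (h2.congr fun m => ?_) h1
  exact hνf (cons_mem_negOrthant (hx m) hr)

theorem ClassT.preservesAbsolutelyMonotone {ψ : (Fin n → ℝ) → ℝ} (hψ : ClassT ψ) (k : ℕ) :
    PreservesAbsolutelyMonotone k ψ := by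
  intro f hf hlim
  by_cases hz : ∃ s ∈ negOrthant n, ψ s = 0
  -- Here `ψ` is identically `0`, and the composite is `f(0, r)` with the variables `s` added as
  -- dummies.
  · refine ((hf.boundary (hlim hz)).comp_reindex (Fin.natAdd n)).congr fun x hx => ?_
    rw [substFirst, hψ.eqOn_zero hz fun i => hx (Fin.castAdd k i)]
    rfl
  · have hneg : ∀ s ∈ negOrthant n, ψ s < 0 := fun s hs =>
      (hψ.2.1 s hs).lt_of_ne fun h => hz ⟨s, hs, h⟩
    have hmaps : MapsTo (fun (x : Fin (n + k) → ℝ) (i : Fin n) => x (Fin.castAdd k i))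
        (negOrthant (n + k)) (negOrthant n) := fun x hx i => hx _
    have hψc : ContDiffOn ℝ ∞ (fun x : Fin (n + k) → ℝ => ψ fun i => x (Fin.castAdd k i))
        (negOrthant (n + k)) := hψ.1.comp (by fun_prop) hmaps
    refine hf.comp (Φ := fun x : Fin (n + k) → ℝ =>
      (Fin.cons (ψ fun i => x (Fin.castAdd k i)) fun j => x (Fin.natAdd n j) :
        Fin (k + 1) → ℝ)) (fun i => ?_) (fun i j => ?_) fun x hx => ?_
    · refine Fin.cases ?_ (fun i => ?_) i
      · simpa only [Fin.cons_zero] using hψc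
      · simp only [Fin.cons_succ]
        exact (contDiff_apply ℝ ℝ _).contDiffOn
    · refine Fin.cases ?_ (fun i => ?_) i
      · simp only [Fin.cons_zero]
        exact absolutelyMonotone_partialDeriv_comp hψ.1 hψ.2.2
          (fun i => (contDiff_apply ℝ ℝ (Fin.castAdd k i)).contDiffOn)
          (fun i j => absolutelyMonotone_partialDeriv_apply (Fin.castAdd k i) j) hmaps j
      · simp only [Fin.cons_succ]
        exact absolutelyMonotone_partialDeriv_apply _ j
    · exact cons_mem_negOrthant (hneg _ (hmaps hx)) fun j => hx _

end Bernstein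

theorem theorem1 (m n : ℕ) (hm : 1 ≤ m) (hn : 1 ≤ n) (ψ : (Fin n → ℝ) → ℝ)
    (hψ : ∀ s ∈ Bernstein.negOrthant n, ψ s ≤ 0) :
    List.TFAE [
      Bernstein.ClassT ψ,
      Bernstein.HasLevyKhintchine ψ,
      Bernstein.PreservesAbsolutelyMonotone (m - 1) ψ] := by
  tfae_have 1 → 2 := Bernstein.ClassT.hasLevyKhintchine
  tfae_have 2 → 1 := Bernstein.HasLevyKhintchine.classT hψ
  tfae_have 1 → 3 := fun h => h.preservesAbsolutelyMonotone (m - 1)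
  tfae_have 3 → 1 := Bernstein.PreservesAbsolutelyMonotone.classT hψ
  tfae_finish
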